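/- Let $p,k$ be non-zero real numbers and $s_1,s_2\in\{1,-1\}$, with $s_1=1$ if $p=1$. Consider the scaled gKdV–LS system $$u_t+s_1u^pu_x+u_{xxx}+s_2(|\psi|^2)_x=0,\qquad i\psi_t+\psi_{xx}+ku\psi=0$$ for a real function $u(t,x)$ and a complex function $\psi(t,x)$. A generator of continuous point symmetries on a domain (a non-empty connected open set) $D$ of $(t,x,u,\psi)$-space on which $u^p$ is defined and smooth (no condition on $u$ if $p\in\mathbb N$; $u\neq0$ if $p$ is a negative integer; $u>0$ otherwise) is a smooth real vector field $X=\tau\partial_t+\xi\partial_x+\eta\partial_u+\varphi\partial_\psi+\bar\varphi\partial_{\bar\psi}$ on $D$, with $\tau,\xi,\eta,\varphi$ functions of $(t,x,u,\psi)$, whose prolongation annihilates both equations at every jet over $D$ that satisfies the system and its differential consequences. Put $$X_1=\partial_t,\quad X_2=\partial_x,\quad X_3=i\psi\partial_\psi-i\bar\psi\partial_{\bar\psi},\quad X_4=t\partial_x+\partial_u+(s_1kt+\tfrac12x)(i\psi\partial_\psi-i\bar\psi\partial_{\bar\psi}).$$ These four vector fields are linearly independent over $\mathbb R$ on every such $D$,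 and the following holds. (i) $X_1,X_2,X_3$ generate continuous point symmetries for every $p\ne0$, and if $p\neq 1$, the generators of continuous point symmetries on $D$ are exactly the real linear combinations of $X_1,X_2,X_3$. The one-parameter groups of $X_1,X_2,X_3$ are, respectively, $t\to t+\epsilon$, $x\to x+\epsilon$, $\psi\to e^{i\epsilon}\psi$ with $\epsilon\in\mathbb R$, and they map solutions of the system to solutions. (ii) Additional continuous point symmetries arise only for $p=1$. If $p=1$, the generators of continuous point symmetries on $D$ are exactly the real linear combinations of $X_1,X_2,X_3,X_4$. The one-parameter group of $X_4$ is then the Galilean boost $$x\to x+\epsilon t,\quad u\to u+\epsilon,\quad \psi\to\exp\big(i(\epsilon(kt+\tfrac12x)+\tfrac14\epsilon^2t)\big)\psi,\qquad\epsilon\in\mathbb R,$$ and it maps solutions of the system to solutions. (iii) The vector fields $X_1,X_2,X_3$ commute, and $[X_1,X_4]=X_2+s_1kX_3$, $[X_2,X_4]=\tfrac12X_3$, $[X_3,X_4]=0$. -/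

import Mathlib

open scoped ContDiff ComplexConjugate

noncomputable section

namespace GKdVLS

/-- The space of independent and dependent variables `(t, x, u, ψ)`. -/
abbrev Space : Type := ℝ × ℝ × ℝ × ℂ

section Derivatives

variable {F : Type*} [NormedAddCommGroup F] [NormedSpace ℝ F]

/-- Partial derivative with respect to `t` of a function of `(t, x)`. -/
def Dt (f : ℝ → ℝ → F) : ℝ → ℝ → F := fun t x => deriv (fun t' => f t' x) t

/-- Partial derivative with respect to `x` of a function of `(t, x)`. -/
def Dx (f : ℝ → ℝ → F) : ℝ → ℝ → F := fun t x => deriv (fun x' => f t x') x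

end Derivatives

/-- The values of `u` near which the real power `u ^ p` is a smooth function given by its usual
meaning: all of `ℝ` if `p` is a natural number, `u ≠ 0` if `p` is an integer, and `u > 0` for
every real `p`. -/
def powDomain (p : ℝ) : Set ℝ :=
  {u | (∃ n : ℕ, p = n) ∨ ((∃ n : ℤ, p = n) ∧ u ≠ 0) ∨ 0 < u}

/-! ### The system -/

/-- Left-hand side of `u_t + s₁ u^p u_x + u_xxx + s₂ (|ψ|²)_x = 0`. -/
def kdv (p s₁ s₂ : ℝ) (u : ℝ → ℝ → ℝ) (ψ : ℝ → ℝ → ℂ) : ℝ → ℝ → ℝ := fun t x =>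
  Dt u t x + s₁ * u t x ^ p * Dx u t x + Dx (Dx (Dx u)) t x
    + s₂ * Dx (fun t' x' => ‖ψ t' x'‖ ^ 2) t x

/-- Left-hand side of `i ψ_t + ψ_xx + k u ψ = 0`. -/
def ls (k : ℝ) (u : ℝ → ℝ → ℝ) (ψ : ℝ → ℝ → ℂ) : ℝ → ℝ → ℂ := fun t x =>
  Complex.I * Dt ψ t x + Dx (Dx ψ) t x + (k : ℂ) * (u t x : ℂ) * ψ t x

/-- `(u, ψ)` is a (smooth, local) solution of the system on the open set `Ω` of the
`(t, x)`-plane. -/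
structure IsSolutionOn (p s₁ s₂ k : ℝ) (Ω : Set (ℝ × ℝ)) (u : ℝ → ℝ → ℝ) (ψ : ℝ → ℝ → ℂ) :
    Prop where
  isOpen : IsOpen Ω
  smooth_u : ContDiffOn ℝ ∞ (fun q : ℝ × ℝ => u q.1 q.2) Ω
  smooth_psi : ContDiffOn ℝ ∞ (fun q : ℝ × ℝ => ψ q.1 q.2) Ω
  mem_powDomain : ∀ q ∈ Ω, u q.1 q.2 ∈ powDomain p
  kdv_eq : ∀ q ∈ Ω, kdv p s₁ s₂ u ψ q.1 q.2 = 0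
  ls_eq : ∀ q ∈ Ω, ls k u ψ q.1 q.2 = 0

/-! ### Vector fields and their prolongations

A vector field `τ ∂_t + ξ ∂_x + η ∂_u + φ ∂_ψ + conj φ ∂_{conj ψ}` on `Space` is given by the map
`X = (τ, ξ, η, φ)`, where `τ`, `ξ`, `η` are real functions and `φ` is a complex function of
`(t, x, u, ψ)`. The prolongation is evaluated on the jet at a point of an arbitrary smooth pair
`(u, ψ)` of functions, along which total derivatives become partial derivatives. -/

/-- The characteristic `η - τ u_t - ξ u_x` of `X`, evaluated along `(u, ψ)`. -/
def charU (X : Space → Space) (u : ℝ → ℝ → ℝ) (ψ : ℝ → ℝ → ℂ) : ℝ → ℝ → ℝ := fun t x =>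
  (X (t, x, u t x, ψ t x)).2.2.1 - (X (t, x, u t x, ψ t x)).1 * Dt u t x
    - (X (t, x, u t x, ψ t x)).2.1 * Dx u t x

/-- The characteristic `φ - τ ψ_t - ξ ψ_x` of `X`, evaluated along `(u, ψ)`. -/
def charPsi (X : Space → Space) (u : ℝ → ℝ → ℝ) (ψ : ℝ → ℝ → ℂ) : ℝ → ℝ → ℂ := fun t x =>
  (X (t, x, u t x, ψ t x)).2.2.2 - ((X (t, x, u t x, ψ t x)).1 : ℂ) * Dt ψ t x
    - ((X (t, x, u t x, ψ t x)).2.1 : ℂ) * Dx ψ t x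

/-- The coefficient of `∂/∂(∂_t^a ∂_x^b u)` in the prolongation of `X`. -/
def prU (X : Space → Space) (a b : ℕ) (u : ℝ → ℝ → ℝ) (ψ : ℝ → ℝ → ℂ) (t x : ℝ) : ℝ :=
  Dt^[a] (Dx^[b] (charU X u ψ)) t x
    + (X (t, x, u t x, ψ t x)).1 * Dt (Dt^[a] (Dx^[b] u)) t x
    + (X (t, x, u t x, ψ t x)).2.1 * Dx (Dt^[a] (Dx^[b] u)) t x

/-- The coefficient of `∂/∂(∂_t^a ∂_x^b ψ)` in the prolongation of `X`; the coefficient of the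
conjugate derivative is its complex conjugate. -/
def prPsi (X : Space → Space) (a b : ℕ) (u : ℝ → ℝ → ℝ) (ψ : ℝ → ℝ → ℂ) (t x : ℝ) : ℂ :=
  Dt^[a] (Dx^[b] (charPsi X u ψ)) t x
    + ((X (t, x, u t x, ψ t x)).1 : ℂ) * Dt (Dt^[a] (Dx^[b] ψ)) t x
    + ((X (t, x, u t x, ψ t x)).2.1 : ℂ) * Dx (Dt^[a] (Dx^[b] ψ)) t x

/-- The prolongation of `X` applied to
`u_t + s₁ u^p u_x + u_xxx + s₂ (ψ conj(ψ_x) + conj(ψ) ψ_x)`. -/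
def prKdv (p s₁ s₂ : ℝ) (X : Space → Space) (u : ℝ → ℝ → ℝ) (ψ : ℝ → ℝ → ℂ) (t x : ℝ) : ℝ :=
  prU X 1 0 u ψ t x
    + s₁ * (p * u t x ^ (p - 1) * prU X 0 0 u ψ t x * Dx u t x + u t x ^ p * prU X 0 1 u ψ t x)
    + prU X 0 3 u ψ t x
    + s₂ * (2 * (conj (prPsi X 0 0 u ψ t x) * Dx ψ t x + conj (ψ t x) * prPsi X 0 1 u ψ t x).re)

/-- The prolongation of `X` applied to `i ψ_t + ψ_xx + k u ψ`. -/
def prLs (k : ℝ) (X : Space → Space) (u : ℝ → ℝ → ℝ) (ψ : ℝ → ℝ → ℂ) (t x : ℝ) : ℂ :=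
  Complex.I * prPsi X 1 0 u ψ t x + prPsi X 0 2 u ψ t x
    + (k : ℂ) * ((prU X 0 0 u ψ t x : ℂ) * ψ t x + (u t x : ℂ) * prPsi X 0 0 u ψ t x)

/-- The third-order jet of `(u, ψ)` at `(t, x)` satisfies the system together with all its
differential consequences of order at most three (the first equation has order three, the second
one order two, so that these consequences are the first derivatives of the second equation). -/
def OnShell (p s₁ s₂ k : ℝ) (u : ℝ → ℝ → ℝ) (ψ : ℝ → ℝ → ℂ) (t x : ℝ) : Prop :=
  kdv p s₁ s₂ u ψ t x = 0 ∧ ls k u ψ t x = 0 ∧ Dt (ls k u ψ) t x = 0 ∧ Dx (ls k u ψ) t x = 0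

/-- `X` is a generator of continuous point symmetries of the system on the open set `D` of
`(t, x, u, ψ)`-space: it is smooth on `D`, and its prolongation annihilates both equations at all
jets over `D` that satisfy the system. -/
def IsPointSymmetry (p s₁ s₂ k : ℝ) (D : Set Space) (X : Space → Space) : Prop :=
  ContDiffOn ℝ ∞ X D ∧
    ∀ (u : ℝ → ℝ → ℝ) (ψ : ℝ → ℝ → ℂ),
      ContDiff ℝ ∞ (fun q : ℝ × ℝ => u q.1 q.2) → ContDiff ℝ ∞ (fun q : ℝ × ℝ => ψ q.1 q.2) →
      ∀ t x : ℝ, (t, x, u t x, ψ t x) ∈ D → OnShell p s₁ s₂ k u ψ t x →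
        prKdv p s₁ s₂ X u ψ t x = 0 ∧ prLs k X u ψ t x = 0

/-! ### The generators -/

/-- `∂_t`. -/
def X₁ : Space → Space := fun _ => (1, 0, 0, 0)

/-- `∂_x`. -/
def X₂ : Space → Space := fun _ => (0, 1, 0, 0)

/-- `i ψ ∂_ψ - i conj(ψ) ∂_{conj ψ}`. -/
def X₃ : Space → Space := fun m => (0, 0, 0, Complex.I * m.2.2.2)

/-- `t ∂_x + ∂_u + (s₁ k t + x / 2) (i ψ ∂_ψ - i conj(ψ) ∂_{conj ψ})`. -/
def X₄ (s₁ k : ℝ) : Space → Space := fun m =>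
  (0, m.1, 1, ((s₁ * k * m.1 + m.2.1 / 2 : ℝ) : ℂ) * (Complex.I * m.2.2.2))

/-! ### The transformation groups -/

/-- Time translation `t → t + ε`. -/
def timeShift (ε : ℝ) : Space → Space := fun m => (m.1 + ε, m.2.1, m.2.2.1, m.2.2.2)

/-- Space translation `x → x + ε`. -/
def spaceShift (ε : ℝ) : Space → Space := fun m => (m.1, m.2.1 + ε, m.2.2.1, m.2.2.2)

/-- Phase rotation `ψ → exp(i ε) ψ`. -/
def phaseRotation (ε : ℝ) : Space → Space := fun m =>
  (m.1, m.2.1, m.2.2.1, Complex.exp (Complex.I * (ε : ℂ)) * m.2.2.2)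

/-- Galilean boost `x → x + ε t`, `u → u + ε`,
`ψ → exp(i (ε (k t + x / 2) + ε² t / 4)) ψ`. -/
def galileanBoost (k ε : ℝ) : Space → Space := fun m =>
  (m.1, m.2.1 + ε * m.1, m.2.2.1 + ε,
    Complex.exp (Complex.I * ((ε * (k * m.1 + m.2.1 / 2) + ε ^ 2 * m.1 / 4 : ℝ) : ℂ)) * m.2.2.2)

/-- `Φ` is the (global) one-parameter group of transformations with generator `X`. -/
def IsFlowOf (X : Space → Space) (Φ : ℝ → Space → Space) : Prop :=
  (∀ m, Φ 0 m = m) ∧ (∀ a b m, Φ (a + b) m = Φ a (Φ b m)) ∧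
    ∀ ε m, HasDerivAt (fun e => Φ e m) (X (Φ ε m)) ε

/-- The graph over `Ω` of a pair of functions. -/
def graphOver (Ω : Set (ℝ × ℝ)) (u : ℝ → ℝ → ℝ) (ψ : ℝ → ℝ → ℂ) : Set Space :=
  (fun q : ℝ × ℝ => (q.1, q.2, u q.1 q.2, ψ q.1 q.2)) '' Ω

/-- The point transformation `g` maps solutions of the system to solutions: the image under `g` of
the graph of any solution is again the graph of a solution. -/
def MapsSolutions (p s₁ s₂ k : ℝ) (g : Space → Space) : Prop :=
  ∀ Ω u ψ, IsSolutionOn p s₁ s₂ k Ω u ψ →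
    ∃ Ω' u' ψ', IsSolutionOn p s₁ s₂ k Ω' u' ψ' ∧ graphOver Ω' u' ψ' = g '' graphOver Ω u ψ

end GKdVLS

end

/-!
The classification follows Lie's method. The infinitesimal condition is evaluated on polynomial
pairs `(u, ψ)` whose jet at a given point is prescribed (`polyJet`): on solution jets the
`x`-derivatives of `u` and `ψ` up to order three are free, and the system determines `u_t`, `ψ_t`,
`ψ_tx` and `ψ_tt` (`onShell_polyJet`). For a field `τ ∂_t + ξ ∂_x + η ∂_u + φ ∂_ψ + c.c.`, with
components written `T`, `Z`, `H`, `Φ` below, the condition becomes two identities between derivatives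
of the components that hold for all values of these free parameters
(`IsPointSymmetry.jet_condition`). They are polynomial in most of the parameters, so that coefficients
can be compared by subtracting two instances.

* `ψ_xxx` in the second equation shows that `τ` depends on `t` only; `u_t` and `ψ_xx` then show that
  `ξ = ξ(t, x)`, that `φ` does not depend on `u` and is holomorphic in `ψ`, and that `τ_t = 2 ξ_x`.
* `u_xxx` in the first equation gives `τ_t = 3 ξ_x`. The two scalings are incompatible, so that
  `τ` is constant and `ξ = ξ(t)`. The coefficient of `ψ_xxx` gives `η_ψ = 0`.
* The rest of the second equation is quadratic in `ψ_x`. With `A = φ_ψ` it gives `A_ψ = 0`,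
  `2 A_x = i ξ_t` and an identity whose `u`- and `ψ`-derivatives yield `η_u = 0` and `φ = A ψ`, and
  finally `A_t = i k η`.
* The first equation then says `Re A = 0`, `ξ_t = s₁ p u ^ (p - 1) η` and
  `η_t + s₁ u ^ p η_x + η_xxx = 0`. Since `ξ` and `η` do not depend on `u`, either `η = 0` or
  `p = 1`; in the latter case `ξ_t = η`, so `η_x = 0` and `η` is constant.

All derivatives are now constant, and connectedness of the domain gives the four-parameter family
(`IsSymmetryField.exists_eq`), with vanishing fourth parameter unless `p = 1`. The converse
(`isPointSymmetry_of_eq`) and the statements on flows, solutions and commutators are direct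
computations.
-/

namespace GKdVLS

noncomputable section

open Filter Topology

/-! ### Directional derivatives -/

section DirDeriv

variable {E F G : Type*} [NormedAddCommGroup E] [NormedSpace ℝ E] [NormedAddCommGroup F]
  [NormedSpace ℝ F] [NormedAddCommGroup G] [NormedSpace ℝ G]

/-- The derivative of `f` in the constant direction `v`, as a function of the point. -/
def dirDeriv (v : E) (f : E → F) : E → F := fun m => fderiv ℝ f m v

variable {D : Set E} {f g : E → F} {m : E}

lemma differentiableAt_of_smoothOn (hD : IsOpen D) (hf : ContDiffOn ℝ ∞ f D) (hm : m ∈ D) :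
    DifferentiableAt ℝ f m :=
  (hf.contDiffAt (hD.mem_nhds hm)).differentiableAt (by simp)

lemma smoothOn_dirDeriv (hD : IsOpen D) (hf : ContDiffOn ℝ ∞ f D) (v : E) :
    ContDiffOn ℝ ∞ (dirDeriv v f) D :=
  (hf.fderiv_of_isOpen hD (by simp)).clm_apply contDiffOn_const

lemma dirDeriv_add_left (v w : E) (f : E → F) (m : E) :
    dirDeriv (v + w) f m = dirDeriv v f m + dirDeriv w f m := by
  simp [dirDeriv]

lemma dirDeriv_smul_left (c : ℝ) (v : E) (f : E → F) (m : E) :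
    dirDeriv (c • v) f m = c • dirDeriv v f m := by
  simp [dirDeriv]

lemma dirDeriv_congr (hD : IsOpen D) (h : ∀ m ∈ D, f m = g m) (hm : m ∈ D) (v : E) :
    dirDeriv v f m = dirDeriv v g m := by
  have : f =ᶠ[𝓝 m] g := by filter_upwards [hD.mem_nhds hm] using h
  simp [dirDeriv, this.fderiv_eq]

lemma dirDeriv_eq_zero (hD : IsOpen D) (h : ∀ m ∈ D, f m = 0) (hm : m ∈ D) (v : E) :
    dirDeriv v f m = 0 := by
  rw [dirDeriv_congr hD (g := fun _ => 0) h hm]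
  simp [dirDeriv]

lemma dirDeriv_clm_comp (hD : IsOpen D) (hf : ContDiffOn ℝ ∞ f D) (hm : m ∈ D) (L : F →L[ℝ] G)
    (v : E) : dirDeriv v (fun m => L (f m)) m = L (dirDeriv v f m) := by
  have := L.hasFDerivAt.comp m (differentiableAt_of_smoothOn hD hf hm).hasFDerivAt
  have := this.fderiv
  simp only [Function.comp_def] at this
  simp [dirDeriv, this]

lemma fderiv_fderiv_apply (hD : IsOpen D) (hf : ContDiffOn ℝ ∞ f D) (hm : m ∈ D) (v w : E) :
    fderiv ℝ (fderiv ℝ f) m v w = dirDeriv v (dirDeriv w f) m := by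
  have h := differentiableAt_of_smoothOn hD (hf.fderiv_of_isOpen hD (m := ∞) (by simp)) hm
  have e := (h.hasFDerivAt.clm_apply (hasFDerivAt_const w m)).fderiv
  change _ = fderiv ℝ (fun y => fderiv ℝ f y w) m v
  simp [e]

lemma dirDeriv_comm (hD : IsOpen D) (hf : ContDiffOn ℝ ∞ f D) (hm : m ∈ D) (v w : E) :
    dirDeriv v (dirDeriv w f) m = dirDeriv w (dirDeriv v f) m := by
  rw [← fderiv_fderiv_apply hD hf hm, ← fderiv_fderiv_apply hD hf hm]
  exact (hf.contDiffAt (hD.mem_nhds hm)).isSymmSndFDerivAt (n := ∞)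
    (by simpa using ENat.LEInfty.out) v w

lemma dirDeriv_dirDeriv_add (hD : IsOpen D) (hf : ContDiffOn ℝ ∞ f D) (hm : m ∈ D) (u v w : E) :
    dirDeriv u (dirDeriv (v + w) f) m
      = dirDeriv u (dirDeriv v f) m + dirDeriv u (dirDeriv w f) m := by
  simp [← fderiv_fderiv_apply hD hf hm]

/-- A function that does not change in the direction `v` has derivatives with the same
property. -/
lemma dirDeriv_dirDeriv_eq_zero (hD : IsOpen D) (hf : ContDiffOn ℝ ∞ f D) {v : E}
    (h : ∀ m ∈ D, dirDeriv v f m = 0) (w : E) : ∀ m ∈ D, dirDeriv v (dirDeriv w f) m = 0 :=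
  fun _ hm => by rw [dirDeriv_comm hD hf hm]; exact dirDeriv_eq_zero hD h hm w

lemma hasDerivAt_comp_curve (hD : IsOpen D) (hf : ContDiffOn ℝ ∞ f D) {γ : ℝ → E} {γ' : E}
    {y : ℝ} (hγ : HasDerivAt γ γ' y) (hm : γ y ∈ D) :
    HasDerivAt (fun y => f (γ y)) (dirDeriv γ' f (γ y)) y :=
  (differentiableAt_of_smoothOn hD hf hm).hasFDerivAt.comp_hasDerivAt y hγ

end DirDeriv

/-! ### Third-order jets of functions of one variable -/

section Jets

variable {F G : Type*} [NormedAddCommGroup F] [NormedSpace ℝ F] [NormedAddCommGroup G]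
  [NormedSpace ℝ G]

/-- `f` is three times differentiable at `x`, where the value and the first three derivatives
are `a`, `b`, `c`, `d`. -/
def HasJet (f : ℝ → F) (x : ℝ) (a b c d : F) : Prop :=
  ∃ g h : ℝ → F, (∀ᶠ y in 𝓝 x, HasDerivAt f (g y) y) ∧ (∀ᶠ y in 𝓝 x, HasDerivAt g (h y) y) ∧
    HasDerivAt h d x ∧ f x = a ∧ g x = b ∧ h x = c

variable {f g : ℝ → F} {x : ℝ} {a b c d a' b' c' d' : F}

lemma HasJet.value (hf : HasJet f x a b c d) : f x = a := by
  obtain ⟨p, q, h1, h2, h3, h4, h5, h6⟩ := hf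
  exact h4

lemma HasJet.deriv₁ (hf : HasJet f x a b c d) : deriv f x = b := by
  obtain ⟨p, q, h1, h2, h3, h4, h5, h6⟩ := hf
  rw [h1.self_of_nhds.deriv, h5]

lemma HasJet.deriv₂ (hf : HasJet f x a b c d) : deriv (deriv f) x = c := by
  obtain ⟨p, q, h1, h2, h3, h4, h5, h6⟩ := hf
  have e1 : deriv f =ᶠ[𝓝 x] p := h1.mono fun y hy => hy.deriv
  rw [e1.deriv_eq, h2.self_of_nhds.deriv, h6]

lemma HasJet.deriv₃ (hf : HasJet f x a b c d) : deriv (deriv (deriv f)) x = d := by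
  obtain ⟨p, q, h1, h2, h3, h4, h5, h6⟩ := hf
  have e1 : deriv f =ᶠ[𝓝 x] p := h1.mono fun y hy => hy.deriv
  have e2 : deriv p =ᶠ[𝓝 x] q := h2.mono fun y hy => hy.deriv
  rw [(e1.deriv.trans e2).deriv_eq, h3.deriv]

lemma HasJet.congr (hf : HasJet f x a b c d) (h : g =ᶠ[𝓝 x] f) : HasJet g x a b c d := by
  obtain ⟨p, q, h1, h2, h3, h4, h5, h6⟩ := hf
  refine ⟨p, q, ?_, h2, h3, h.self_of_nhds.trans h4, h5, h6⟩
  filter_upwards [h1, h.eventuallyEq_nhds] with y hy hy'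
  exact hy.congr_of_eventuallyEq hy'

lemma hasJet_const (a : F) (x : ℝ) : HasJet (fun _ => a) x a 0 0 0 :=
  ⟨fun _ => 0, fun _ => 0, .of_forall fun y => hasDerivAt_const y a,
    .of_forall fun y => hasDerivAt_const y 0, hasDerivAt_const x 0, rfl, rfl, rfl⟩

lemma HasJet.sub (hf : HasJet f x a b c d) (hg : HasJet g x a' b' c' d') :
    HasJet (fun y => f y - g y) x (a - a') (b - b') (c - c') (d - d') := by
  obtain ⟨p, q, h1, h2, h3, rfl, rfl, rfl⟩ := hf
  obtain ⟨p', q', h1', h2', h3', rfl, rfl, rfl⟩ := hg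
  exact ⟨fun y => p y - p' y, fun y => q y - q' y, (h1.and h1').mono fun y hy => hy.1.sub hy.2,
    (h2.and h2').mono fun y hy => hy.1.sub hy.2, h3.sub h3', rfl, rfl, rfl⟩

lemma HasJet.smul {r : ℝ → ℝ} {r₀ r₁ r₂ r₃ : ℝ} (hr : HasJet r x r₀ r₁ r₂ r₃)
    (hf : HasJet f x a b c d) :
    HasJet (fun y => r y • f y) x (r₀ • a) (r₀ • b + r₁ • a) (r₀ • c + (2 * r₁) • b + r₂ • a)
      (r₀ • d + (3 * r₁) • c + (3 * r₂) • b + r₃ • a) := by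
  obtain ⟨p, q, h1, h2, h3, rfl, rfl, rfl⟩ := hf
  obtain ⟨p', q', h1', h2', h3', rfl, rfl, rfl⟩ := hr
  refine ⟨fun y => r y • p y + p' y • f y, fun y => r y • q y + (2 * p' y) • p y + q' y • f y,
    (h1.and h1').mono fun y hy => hy.2.smul hy.1, ?_, ?_, rfl, rfl, rfl⟩
  · filter_upwards [h1, h2, h1', h2'] with y e1 e2 e1' e2'
    refine ((e1'.smul e2).add (e2'.smul e1)).congr_deriv ?_
    module
  · refine (((h1'.self_of_nhds.smul h3).add
      ((h2'.self_of_nhds.const_mul 2).smul h2.self_of_nhds)).add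
      (h3'.smul h1.self_of_nhds)).congr_deriv ?_
    module

end Jets

section CurveJets

variable {E F : Type*} [NormedAddCommGroup E] [NormedSpace ℝ E] [NormedAddCommGroup F]
  [NormedSpace ℝ F] {D : Set E} {f : E → F}

/-- The third-order chain rule along a curve. -/
lemma hasJet_comp_curve (hD : IsOpen D) (hf : ContDiffOn ℝ ∞ f D) {γ γ₁ γ₂ : ℝ → E} {γ₃ : E}
    {x : ℝ} (h1 : ∀ y, HasDerivAt γ (γ₁ y) y) (h2 : ∀ y, HasDerivAt γ₁ (γ₂ y) y)
    (h3 : HasDerivAt γ₂ γ₃ x) (hx : γ x ∈ D) :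
    HasJet (fun y => f (γ y)) x (f (γ x)) (dirDeriv (γ₁ x) f (γ x))
      (dirDeriv (γ₁ x) (dirDeriv (γ₁ x) f) (γ x) + dirDeriv (γ₂ x) f (γ x))
      (dirDeriv (γ₁ x) (dirDeriv (γ₁ x) (dirDeriv (γ₁ x) f)) (γ x)
        + (3 : ℝ) • dirDeriv (γ₁ x) (dirDeriv (γ₂ x) f) (γ x) + dirDeriv γ₃ f (γ x)) := by
  have hev : ∀ᶠ y in 𝓝 x, γ y ∈ D := (h1 x).continuousAt.eventually (hD.mem_nhds hx)
  have hf1 := hf.fderiv_of_isOpen hD (m := ∞) (by simp)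
  have hf2 := hf1.fderiv_of_isOpen hD (m := ∞) (by simp)
  have key : ∀ m ∈ D, ∀ u v w : E, fderiv ℝ (fderiv ℝ (fderiv ℝ f)) m u v w
      = dirDeriv u (dirDeriv v (dirDeriv w f)) m := by
    intro m hm u v w
    rw [fderiv_fderiv_apply hD hf1 hm]
    have := dirDeriv_congr hD (f := fun m => fderiv ℝ (fderiv ℝ f) m v w)
      (fun m hm => fderiv_fderiv_apply hD hf hm v w) hm u
    rw [← this]
    exact (dirDeriv_clm_comp hD (smoothOn_dirDeriv hD hf1 v) hm
      (ContinuousLinearMap.apply ℝ F w) u).symm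
  refine ⟨fun y => fderiv ℝ f (γ y) (γ₁ y),
    fun y => fderiv ℝ (fderiv ℝ f) (γ y) (γ₁ y) (γ₁ y) + fderiv ℝ f (γ y) (γ₂ y),
    ?_, ?_, ?_, rfl, rfl, ?_⟩
  · filter_upwards [hev] with y hy using hasDerivAt_comp_curve hD hf (h1 y) hy
  · filter_upwards [hev] with y hy
    exact (hasDerivAt_comp_curve hD hf1 (h1 y) hy).clm_apply (h2 y)
  · have e1 := ((hasDerivAt_comp_curve hD hf2 (h1 x) hx).clm_apply (h2 x)).clm_apply (h2 x)
    have e2 := (hasDerivAt_comp_curve hD hf1 (h1 x) hx).clm_apply h3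
    refine (e1.add e2).congr_deriv ?_
    have s1 := dirDeriv_comm hD hf hx (γ₂ x) (γ₁ x)
    simp only [← key _ hx, ← fderiv_fderiv_apply hD hf hx] at s1 ⊢
    simp only [dirDeriv, add_apply, s1]
    module
  · simp only [fderiv_fderiv_apply hD hf hx]
    rfl

end CurveJets

/-! ### Functions of `(t, x)` -/

section PlaneFunctions

variable {F : Type*} [NormedAddCommGroup F] [NormedSpace ℝ F] {Ω : Set (ℝ × ℝ)}
  {f g : ℝ → ℝ → F} {t x : ℝ}

/-- `f` is a smooth function of the pair `(t, x)` on `Ω`. -/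
def SmoothOn (Ω : Set (ℝ × ℝ)) (f : ℝ → ℝ → F) : Prop :=
  ContDiffOn ℝ ∞ (fun q : ℝ × ℝ => f q.1 q.2) Ω

lemma hasDerivAt_pair_left (t x : ℝ) : HasDerivAt (fun s : ℝ => (s, x)) ((1, 0) : ℝ × ℝ) t :=
  (hasDerivAt_id t).prodMk (hasDerivAt_const t x)

lemma hasDerivAt_pair_right (t x : ℝ) : HasDerivAt (fun y : ℝ => (t, y)) ((0, 1) : ℝ × ℝ) x :=
  (hasDerivAt_const x t).prodMk (hasDerivAt_id x)

lemma Dt_eq_dirDeriv (hΩ : IsOpen Ω) (hf : SmoothOn Ω f) (h : (t, x) ∈ Ω) :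
    Dt f t x = dirDeriv (1, 0) (fun q : ℝ × ℝ => f q.1 q.2) (t, x) :=
  (hasDerivAt_comp_curve hΩ hf (hasDerivAt_pair_left t x) h).deriv

lemma Dx_eq_dirDeriv (hΩ : IsOpen Ω) (hf : SmoothOn Ω f) (h : (t, x) ∈ Ω) :
    Dx f t x = dirDeriv (0, 1) (fun q : ℝ × ℝ => f q.1 q.2) (t, x) :=
  (hasDerivAt_comp_curve hΩ hf (hasDerivAt_pair_right t x) h).deriv

lemma SmoothOn.Dt (hΩ : IsOpen Ω) (hf : SmoothOn Ω f) : SmoothOn Ω (Dt f) :=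
  (smoothOn_dirDeriv hΩ hf _).congr fun _ hq => Dt_eq_dirDeriv hΩ hf hq

lemma SmoothOn.Dx (hΩ : IsOpen Ω) (hf : SmoothOn Ω f) : SmoothOn Ω (Dx f) :=
  (smoothOn_dirDeriv hΩ hf _).congr fun _ hq => Dx_eq_dirDeriv hΩ hf hq

lemma Dt_Dx_comm (hΩ : IsOpen Ω) (hf : SmoothOn Ω f) (h : (t, x) ∈ Ω) :
    GKdVLS.Dt (GKdVLS.Dx f) t x = GKdVLS.Dx (GKdVLS.Dt f) t x := by
  rw [Dt_eq_dirDeriv hΩ (hf.Dx hΩ) h, Dx_eq_dirDeriv hΩ (hf.Dt hΩ) h,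
    dirDeriv_congr hΩ (fun q hq => Dx_eq_dirDeriv hΩ hf hq) h,
    dirDeriv_congr hΩ (fun q hq => Dt_eq_dirDeriv hΩ hf hq) h, dirDeriv_comm hΩ hf h]

lemma SmoothOn.hasDerivAt_comp (hΩ : IsOpen Ω) (hf : SmoothOn Ω f) {a b : ℝ → ℝ} {a' b' s : ℝ}
    (ha : HasDerivAt a a' s) (hb : HasDerivAt b b' s) (h : (a s, b s) ∈ Ω) :
    HasDerivAt (fun s => f (a s) (b s))
      (a' • GKdVLS.Dt f (a s) (b s) + b' • GKdVLS.Dx f (a s) (b s)) s := by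
  refine (hasDerivAt_comp_curve hΩ hf (ha.prodMk hb) h).congr_deriv ?_
  rw [Dt_eq_dirDeriv hΩ hf h, Dx_eq_dirDeriv hΩ hf h, ← dirDeriv_smul_left, ← dirDeriv_smul_left,
    ← dirDeriv_add_left]
  simp

lemma SmoothOn.hasDerivAt_left (hΩ : IsOpen Ω) (hf : SmoothOn Ω f) (h : (t, x) ∈ Ω) :
    HasDerivAt (fun s => f s x) (GKdVLS.Dt f t x) t := by
  simpa using hf.hasDerivAt_comp hΩ (hasDerivAt_id t) (hasDerivAt_const t x) h

lemma SmoothOn.hasDerivAt_right (hΩ : IsOpen Ω) (hf : SmoothOn Ω f) (h : (t, x) ∈ Ω) :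
    HasDerivAt (f t) (GKdVLS.Dx f t x) x := by
  simpa using hf.hasDerivAt_comp hΩ (hasDerivAt_const x t) (hasDerivAt_id x) h

lemma SmoothOn.eventually_mem (hΩ : IsOpen Ω) (h : (t, x) ∈ Ω) : ∀ᶠ y in 𝓝 x, (t, y) ∈ Ω :=
  (hasDerivAt_pair_right t x).continuousAt.eventually (hΩ.mem_nhds h)

lemma Dx_congr (hΩ : IsOpen Ω) (h : ∀ q ∈ Ω, f q.1 q.2 = g q.1 q.2) (hq : (t, x) ∈ Ω) :
    Dx f t x = Dx g t x :=
  Filter.EventuallyEq.deriv_eq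
    ((SmoothOn.eventually_mem hΩ hq).mono fun y hy => h (t, y) hy)

lemma SmoothOn.hasJet (hΩ : IsOpen Ω) (hf : SmoothOn Ω f) (h : (t, x) ∈ Ω) :
    HasJet (f t) x (f t x) (GKdVLS.Dx f t x) (GKdVLS.Dx (GKdVLS.Dx f) t x)
      (GKdVLS.Dx (GKdVLS.Dx (GKdVLS.Dx f)) t x) := by
  have hev := SmoothOn.eventually_mem hΩ h
  have h1 := hf.Dx hΩ
  exact ⟨GKdVLS.Dx f t, GKdVLS.Dx (GKdVLS.Dx f) t, hev.mono fun y hy => hf.hasDerivAt_right hΩ hy,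
    hev.mono fun y hy => h1.hasDerivAt_right hΩ hy, (h1.Dx hΩ).hasDerivAt_right hΩ h, rfl, rfl, rfl⟩

lemma Dx_norm_sq {ψ : ℝ → ℝ → ℂ} (h : HasDerivAt (ψ t) (Dx ψ t x) x) :
    Dx (fun t x => ‖ψ t x‖ ^ 2) t x = 2 * (conj (ψ t x) * Dx ψ t x).re := by
  have h' : HasDerivAt (fun y => ‖ψ t y‖ ^ 2) (2 * inner ℝ (ψ t x) (Dx ψ t x)) x := h.norm_sq
  refine h'.deriv.trans ?_
  rw [Complex.inner, mul_comm (Dx ψ t x)]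

end PlaneFunctions

/-! ### Prolongation coefficients -/

section Prolongation

variable {F : Type*} [NormedAddCommGroup F] [NormedSpace ℝ F] {f : ℝ → ℝ → F} {t x : ℝ}

/-- The `x`-jet of a characteristic `N - T f_t - Z f_x`, which is the Leibniz rule behind the
prolongation formulas. -/
lemma hasJet_characteristic (hf : SmoothOn Set.univ f) {N : ℝ → F} {T Z : ℝ → ℝ}
    {N₀ N₁ N₂ N₃ : F} {T₀ T₁ T₂ T₃ Z₀ Z₁ Z₂ Z₃ : ℝ} (hN : HasJet N x N₀ N₁ N₂ N₃)
    (hT : HasJet T x T₀ T₁ T₂ T₃) (hZ : HasJet Z x Z₀ Z₁ Z₂ Z₃) :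
    HasJet (fun y => N y - T y • Dt f t y - Z y • Dx f t y) x
      (N₀ - T₀ • Dt f t x - Z₀ • Dx f t x)
      (N₁ - T₁ • Dt f t x - Z₁ • Dx f t x - T₀ • Dt (Dx f) t x - Z₀ • Dx (Dx f) t x)
      (N₂ - T₂ • Dt f t x - Z₂ • Dx f t x - (2 * T₁) • Dx (Dt f) t x - (2 * Z₁) • Dx (Dx f) t x
        - T₀ • Dt (Dx (Dx f)) t x - Z₀ • Dx (Dx (Dx f)) t x)
      (N₃ - T₃ • Dt f t x - Z₃ • Dx f t x - (3 * T₂) • Dx (Dt f) t x - (3 * Z₂) • Dx (Dx f) t x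
        - (3 * T₁) • Dx (Dx (Dt f)) t x - (3 * Z₁) • Dx (Dx (Dx f)) t x
        - T₀ • Dt (Dx (Dx (Dx f))) t x - Z₀ • Dx (Dx (Dx (Dx f))) t x) := by
  have hu : (t, x) ∈ (Set.univ : Set (ℝ × ℝ)) := trivial
  have ho : IsOpen (Set.univ : Set (ℝ × ℝ)) := isOpen_univ
  have h1 := hf.Dx ho
  have h2 := h1.Dx ho
  have c1 := Dt_Dx_comm ho hf hu
  have c2 : Dt (Dx (Dx f)) t x = Dx (Dx (Dt f)) t x :=
    (Dt_Dx_comm ho h1 hu).trans (Dx_congr ho (fun q hq => Dt_Dx_comm ho hf hq) hu)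
  have c3 : Dt (Dx (Dx (Dx f))) t x = Dx (Dx (Dx (Dt f))) t x :=
    (Dt_Dx_comm ho h2 hu).trans (Dx_congr ho (fun q hq => (Dt_Dx_comm ho h1 hq).trans
      (Dx_congr ho (fun q hq => Dt_Dx_comm ho hf hq) hq)) hu)
  have J := (hN.sub (hT.smul ((hf.Dt ho).hasJet ho hu))).sub (hZ.smul (h1.hasJet ho hu))
  rw [c1, c2, c3]
  convert J using 1 <;> module

/-- The `t`-derivative of a characteristic `N - T f_t - Z f_x`. -/
lemma hasDerivAt_characteristic (hf : SmoothOn Set.univ f) {N : ℝ → F} {T Z : ℝ → ℝ} {N₁ : F}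
    {T₁ Z₁ : ℝ} (hN : HasDerivAt N N₁ t) (hT : HasDerivAt T T₁ t) (hZ : HasDerivAt Z Z₁ t) :
    HasDerivAt (fun s => N s - T s • Dt f s x - Z s • Dx f s x)
      (N₁ - T₁ • Dt f t x - Z₁ • Dx f t x - T t • Dt (Dt f) t x - Z t • Dx (Dt f) t x) t := by
  have hu : (t, x) ∈ (Set.univ : Set (ℝ × ℝ)) := trivial
  have ho : IsOpen (Set.univ : Set (ℝ × ℝ)) := isOpen_univ
  refine ((hN.sub (hT.smul ((hf.Dt ho).hasDerivAt_left ho hu))).sub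
    (hZ.smul ((hf.Dx ho).hasDerivAt_left ho hu))).congr_deriv ?_
  rw [Dt_Dx_comm ho hf hu]
  module

variable {X : Space → Space} {u : ℝ → ℝ → ℝ} {ψ : ℝ → ℝ → ℂ}

lemma prU_zero_zero : prU X 0 0 u ψ t x = (X (t, x, u t x, ψ t x)).2.2.1 := by
  simp only [prU, charU, Function.iterate_zero, id]
  ring

lemma prPsi_zero_zero : prPsi X 0 0 u ψ t x = (X (t, x, u t x, ψ t x)).2.2.2 := by
  simp only [prPsi, charPsi, Function.iterate_zero, id]
  ring

lemma prU_one_zero (hu : SmoothOn Set.univ u) {T₁ Z₁ N₁ : ℝ}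
    (hT : HasDerivAt (fun s => (X (s, x, u s x, ψ s x)).1) T₁ t)
    (hZ : HasDerivAt (fun s => (X (s, x, u s x, ψ s x)).2.1) Z₁ t)
    (hN : HasDerivAt (fun s => (X (s, x, u s x, ψ s x)).2.2.1) N₁ t) :
    prU X 1 0 u ψ t x = N₁ - T₁ * Dt u t x - Z₁ * Dx u t x := by
  have h : Dt (charU X u ψ) t x = _ := (hasDerivAt_characteristic hu hN hT hZ).deriv
  simp only [prU, Function.iterate_zero, Function.iterate_one, id, h, smul_eq_mul]
  ring

lemma prPsi_one_zero (hψ : SmoothOn Set.univ ψ) {T₁ Z₁ : ℝ} {N₁ : ℂ}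
    (hT : HasDerivAt (fun s => (X (s, x, u s x, ψ s x)).1) T₁ t)
    (hZ : HasDerivAt (fun s => (X (s, x, u s x, ψ s x)).2.1) Z₁ t)
    (hN : HasDerivAt (fun s => (X (s, x, u s x, ψ s x)).2.2.2) N₁ t) :
    prPsi X 1 0 u ψ t x = N₁ - T₁ * Dt ψ t x - Z₁ * Dx ψ t x := by
  have h := (hasDerivAt_characteristic (x := x) hψ hN hT hZ).deriv
  simp only [Complex.real_smul] at h
  have h : Dt (charPsi X u ψ) t x = _ := h
  simp only [prPsi, Function.iterate_zero, Function.iterate_one, id, h]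
  ring

lemma prU_zero_one (hu : SmoothOn Set.univ u) {T₀ T₁ T₂ T₃ Z₀ Z₁ Z₂ Z₃ N₀ N₁ N₂ N₃ : ℝ}
    (hT : HasJet (fun y => (X (t, y, u t y, ψ t y)).1) x T₀ T₁ T₂ T₃)
    (hZ : HasJet (fun y => (X (t, y, u t y, ψ t y)).2.1) x Z₀ Z₁ Z₂ Z₃)
    (hN : HasJet (fun y => (X (t, y, u t y, ψ t y)).2.2.1) x N₀ N₁ N₂ N₃) :
    prU X 0 1 u ψ t x = N₁ - T₁ * Dt u t x - Z₁ * Dx u t x := by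
  have h : Dx (charU X u ψ) t x = _ := (hasJet_characteristic hu hN hT hZ).deriv₁
  simp only [prU, Function.iterate_zero, Function.iterate_one, id, h, smul_eq_mul, hT.value,
    hZ.value]
  ring

lemma prU_zero_three (hu : SmoothOn Set.univ u) {T₀ T₁ T₂ T₃ Z₀ Z₁ Z₂ Z₃ N₀ N₁ N₂ N₃ : ℝ}
    (hT : HasJet (fun y => (X (t, y, u t y, ψ t y)).1) x T₀ T₁ T₂ T₃)
    (hZ : HasJet (fun y => (X (t, y, u t y, ψ t y)).2.1) x Z₀ Z₁ Z₂ Z₃)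
    (hN : HasJet (fun y => (X (t, y, u t y, ψ t y)).2.2.1) x N₀ N₁ N₂ N₃) :
    prU X 0 3 u ψ t x = N₃ - T₃ * Dt u t x - Z₃ * Dx u t x - 3 * T₂ * Dx (Dt u) t x
      - 3 * Z₂ * Dx (Dx u) t x - 3 * T₁ * Dx (Dx (Dt u)) t x
      - 3 * Z₁ * Dx (Dx (Dx u)) t x := by
  have h : Dx (Dx (Dx (charU X u ψ))) t x = _ := (hasJet_characteristic hu hN hT hZ).deriv₃
  simp only [prU, Function.iterate_succ, Function.iterate_zero, Function.comp_apply, id, h,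
    smul_eq_mul, hT.value, hZ.value]
  ring

lemma prPsi_zero_one (hψ : SmoothOn Set.univ ψ) {T₀ T₁ T₂ T₃ Z₀ Z₁ Z₂ Z₃ : ℝ} {N₀ N₁ N₂ N₃ : ℂ}
    (hT : HasJet (fun y => (X (t, y, u t y, ψ t y)).1) x T₀ T₁ T₂ T₃)
    (hZ : HasJet (fun y => (X (t, y, u t y, ψ t y)).2.1) x Z₀ Z₁ Z₂ Z₃)
    (hN : HasJet (fun y => (X (t, y, u t y, ψ t y)).2.2.2) x N₀ N₁ N₂ N₃) :
    prPsi X 0 1 u ψ t x = N₁ - T₁ * Dt ψ t x - Z₁ * Dx ψ t x := by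
  have h := (hasJet_characteristic (t := t) hψ hN hT hZ).deriv₁
  simp only [Complex.real_smul] at h
  have h : Dx (charPsi X u ψ) t x = _ := h
  simp only [prPsi, Function.iterate_zero, Function.iterate_one, id, h, hT.value, hZ.value]
  ring

lemma prPsi_zero_two (hψ : SmoothOn Set.univ ψ) {T₀ T₁ T₂ T₃ Z₀ Z₁ Z₂ Z₃ : ℝ} {N₀ N₁ N₂ N₃ : ℂ}
    (hT : HasJet (fun y => (X (t, y, u t y, ψ t y)).1) x T₀ T₁ T₂ T₃)
    (hZ : HasJet (fun y => (X (t, y, u t y, ψ t y)).2.1) x Z₀ Z₁ Z₂ Z₃)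
    (hN : HasJet (fun y => (X (t, y, u t y, ψ t y)).2.2.2) x N₀ N₁ N₂ N₃) :
    prPsi X 0 2 u ψ t x = N₂ - T₂ * Dt ψ t x - Z₂ * Dx ψ t x - 2 * T₁ * Dx (Dt ψ) t x
      - 2 * Z₁ * Dx (Dx ψ) t x := by
  have h := (hasJet_characteristic (t := t) hψ hN hT hZ).deriv₂
  simp only [Complex.real_smul] at h
  have h : Dx (Dx (charPsi X u ψ)) t x = _ := h
  simp only [prPsi, Function.iterate_succ, Function.iterate_zero, Function.comp_apply, id, h,
    hT.value, hZ.value]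
  push_cast
  ring

end Prolongation

/-! ### Functions with a prescribed jet -/

section PolyJet

variable {F : Type*} [NormedAddCommGroup F] [NormedSpace ℝ F]

/-- The polynomial in `(t, x)` whose `x`-derivatives up to order three, `t`-derivative, mixed
derivative and second `t`-derivative at `(t₀, x₀)` are prescribed. The derivatives of such a
polynomial have the same form. -/
def polyJet (t₀ x₀ : ℝ) (c₀ c₁ c₂ c₃ b₀ b₁ d : F) : ℝ → ℝ → F := fun t x =>
  c₀ + (x - x₀) • c₁ + ((x - x₀) ^ 2 / 2) • c₂ + ((x - x₀) ^ 3 / 6) • c₃ + (t - t₀) • b₀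
    + ((t - t₀) * (x - x₀)) • b₁ + ((t - t₀) ^ 2 / 2) • d

variable (t₀ x₀ : ℝ) (c₀ c₁ c₂ c₃ b₀ b₁ d : F)

lemma polyJet_self : polyJet t₀ x₀ c₀ c₁ c₂ c₃ b₀ b₁ d t₀ x₀ = c₀ := by
  simp [polyJet]

lemma smoothOn_polyJet : SmoothOn Set.univ (polyJet t₀ x₀ c₀ c₁ c₂ c₃ b₀ b₁ d) := by
  unfold SmoothOn polyJet
  fun_prop

lemma hasDerivAt_polyJet_right (t x : ℝ) :
    HasDerivAt (polyJet t₀ x₀ c₀ c₁ c₂ c₃ b₀ b₁ d t)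
      (polyJet t₀ x₀ c₁ c₂ c₃ 0 b₁ 0 0 t x) x := by
  have h := (hasDerivAt_id x).sub_const x₀
  have h1 := h.smul_const c₁
  have h2 := ((h.pow 2).div_const 2).smul_const c₂
  have h3 := ((h.pow 3).div_const 6).smul_const c₃
  have h4 := (h.const_mul (t - t₀)).smul_const b₁
  refine ((((((h1.const_add c₀).add h2).add h3).add_const ((t - t₀) • b₀)).add h4).add_const
    (((t - t₀) ^ 2 / 2) • d)).congr_deriv ?_
  simp only [polyJet, id]
  push_cast
  module

lemma hasDerivAt_polyJet_left (t x : ℝ) :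
    HasDerivAt (fun s => polyJet t₀ x₀ c₀ c₁ c₂ c₃ b₀ b₁ d s x)
      (polyJet t₀ x₀ b₀ b₁ 0 0 d 0 0 t x) t := by
  have h := (hasDerivAt_id t).sub_const t₀
  have h1 := h.smul_const b₀
  have h2 := (h.mul_const (x - x₀)).smul_const b₁
  have h3 := ((h.pow 2).div_const 2).smul_const d
  refine (((h1.const_add (c₀ + (x - x₀) • c₁ + ((x - x₀) ^ 2 / 2) • c₂
    + ((x - x₀) ^ 3 / 6) • c₃)).add h2).add h3).congr_deriv ?_
  simp only [polyJet, id]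
  push_cast
  module

lemma Dx_polyJet : Dx (polyJet t₀ x₀ c₀ c₁ c₂ c₃ b₀ b₁ d) = polyJet t₀ x₀ c₁ c₂ c₃ 0 b₁ 0 0 :=
  funext₂ fun t x => (hasDerivAt_polyJet_right t₀ x₀ c₀ c₁ c₂ c₃ b₀ b₁ d t x).deriv

lemma Dt_polyJet : Dt (polyJet t₀ x₀ c₀ c₁ c₂ c₃ b₀ b₁ d) = polyJet t₀ x₀ b₀ b₁ 0 0 d 0 0 :=
  funext₂ fun t x => (hasDerivAt_polyJet_left t₀ x₀ c₀ c₁ c₂ c₃ b₀ b₁ d t x).deriv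

end PolyJet

/-- Every choice of `x`-derivatives `u₁, u₂, u₃, w₁, w₂, w₃` extends to the jet of a smooth pair
that satisfies the system and its differential consequences: the system determines `u_t`, `ψ_t`,
`ψ_tx` and `ψ_tt`. -/
lemma onShell_polyJet {p s₁ s₂ k t x u₀ u₁ u₂ u₃ a : ℝ} {ψ₀ w₁ w₂ w₃ b₀ b₁ : ℂ}
    (ha : a = -(s₁ * u₀ ^ p * u₁ + u₃ + s₂ * (2 * (conj ψ₀ * w₁).re)))
    (hb₀ : b₀ = Complex.I * (w₂ + k * u₀ * ψ₀))
    (hb₁ : b₁ = Complex.I * (w₃ + k * (u₁ * ψ₀ + u₀ * w₁))) :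
    OnShell p s₁ s₂ k (polyJet t x u₀ u₁ u₂ u₃ a 0 0)
      (polyJet t x ψ₀ w₁ w₂ w₃ b₀ b₁ (Complex.I * (k * (a * ψ₀ + u₀ * b₀)))) t x := by
  have hI := Complex.I_mul_I
  refine ⟨?_, ?_, ?_, ?_⟩
  · have h := Dx_norm_sq (t := t) (x := x)
      (ψ := polyJet t x ψ₀ w₁ w₂ w₃ b₀ b₁ (Complex.I * (k * (a * ψ₀ + u₀ * b₀))))
      (by rw [Dx_polyJet]; exact hasDerivAt_polyJet_right ..)
    unfold kdv
    rw [h]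
    simp only [Dx_polyJet, Dt_polyJet, polyJet_self]
    linear_combination ha
  · simp only [ls, Dx_polyJet, Dt_polyJet, polyJet_self, hb₀]
    linear_combination (w₂ + k * u₀ * ψ₀) * hI
  · refine HasDerivAt.deriv (f' := 0) ?_
    simp only [ls, Dx_polyJet, Dt_polyJet]
    refine ((((hasDerivAt_polyJet_left ..).const_mul Complex.I).add
      (hasDerivAt_polyJet_left ..)).add
      (((hasDerivAt_polyJet_left ..).ofReal_comp.const_mul (k : ℂ)).mul
        (hasDerivAt_polyJet_left ..))).congr_deriv ?_
    simp only [polyJet_self]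
    linear_combination (k * (a * ψ₀ + u₀ * b₀)) * hI
  · refine HasDerivAt.deriv (f' := 0) ?_
    simp only [ls, Dx_polyJet, Dt_polyJet]
    refine ((((hasDerivAt_polyJet_right ..).const_mul Complex.I).add
      (hasDerivAt_polyJet_right ..)).add
      (((hasDerivAt_polyJet_right ..).ofReal_comp.const_mul (k : ℂ)).mul
        (hasDerivAt_polyJet_right ..))).congr_deriv ?_
    simp only [polyJet_self, hb₁]
    linear_combination (w₃ + k * (u₁ * ψ₀ + u₀ * w₁)) * hI

/-! ### The symmetry condition in jet coordinates -/

section JetCondition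

variable {F : Type*} [NormedAddCommGroup F] [NormedSpace ℝ F]

/-- The second derivative of `f` along a curve through `m` with derivatives `v₁`, `v₂`. -/
def jet₂ (v₁ v₂ : Space) (f : Space → F) (m : Space) : F :=
  dirDeriv v₁ (dirDeriv v₁ f) m + dirDeriv v₂ f m

/-- The third derivative of `f` along a curve through `m` with derivatives `v₁`, `v₂`, `v₃`. -/
def jet₃ (v₁ v₂ v₃ : Space) (f : Space → F) (m : Space) : F :=
  dirDeriv v₁ (dirDeriv v₁ (dirDeriv v₁ f)) m + (3 : ℝ) • dirDeriv v₁ (dirDeriv v₂ f) m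
    + dirDeriv v₃ f m

/-- The vector field `T ∂_t + Z ∂_x + H ∂_u + Φ ∂_ψ + conj Φ ∂_{conj ψ}`. -/
def field (T Z H : Space → ℝ) (Φ : Space → ℂ) : Space → Space := fun m => (T m, Z m, H m, Φ m)

/-- The infinitesimal symmetry condition, written out at the point `(t, x, u₀, ψ₀)` for the jet
with `x`-derivatives `u₁, u₂, u₃, w₁, w₂, w₃`, in terms of the derivatives of the components of the
vector field. -/
lemma IsPointSymmetry.jet_condition {p s₁ s₂ k : ℝ} {D : Set Space} (hD : IsOpen D)
    {T Z H : Space → ℝ} {Φ : Space → ℂ} (hT : ContDiffOn ℝ ∞ T D) (hZ : ContDiffOn ℝ ∞ Z D)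
    (hH : ContDiffOn ℝ ∞ H D) (hΦ : ContDiffOn ℝ ∞ Φ D)
    (hX : IsPointSymmetry p s₁ s₂ k D (field T Z H Φ))
    {t x u₀ : ℝ} {ψ₀ : ℂ} (hm : (t, x, u₀, ψ₀) ∈ D) (u₁ u₂ u₃ : ℝ) (w₁ w₂ w₃ : ℂ)
    {a : ℝ} {b₀ b₁ : ℂ}
    (ha : a = -(s₁ * u₀ ^ p * u₁ + u₃ + s₂ * (2 * (conj ψ₀ * w₁).re)))
    (hb₀ : b₀ = Complex.I * (w₂ + k * u₀ * ψ₀))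
    (hb₁ : b₁ = Complex.I * (w₃ + k * (u₁ * ψ₀ + u₀ * w₁)))
    {m V v₁ v₂ v₃ : Space} (hm' : m = (t, x, u₀, ψ₀)) (hV : V = (1, 0, a, b₀))
    (hv₁ : v₁ = (0, 1, u₁, w₁)) (hv₂ : v₂ = (0, 0, u₂, w₂)) (hv₃ : v₃ = (0, 0, u₃, w₃)) :
    (dirDeriv V H m - dirDeriv V T m * a - dirDeriv V Z m * u₁
      + s₁ * (p * u₀ ^ (p - 1) * H m * u₁
        + u₀ ^ p * (dirDeriv v₁ H m - dirDeriv v₁ T m * a - dirDeriv v₁ Z m * u₁))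
      + (jet₃ v₁ v₂ v₃ H m - jet₃ v₁ v₂ v₃ T m * a - jet₃ v₁ v₂ v₃ Z m * u₁
        - 3 * jet₂ v₁ v₂ Z m * u₂ - 3 * dirDeriv v₁ Z m * u₃)
      + s₂ * (2 * (conj (Φ m) * w₁ + conj ψ₀ *
        (dirDeriv v₁ Φ m - dirDeriv v₁ T m * b₀ - dirDeriv v₁ Z m * w₁)).re) = 0) ∧
    (Complex.I * (dirDeriv V Φ m - dirDeriv V T m * b₀ - dirDeriv V Z m * w₁)
      + (jet₂ v₁ v₂ Φ m - jet₂ v₁ v₂ T m * b₀ - jet₂ v₁ v₂ Z m * w₁ - 2 * dirDeriv v₁ T m * b₁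
        - 2 * dirDeriv v₁ Z m * w₂)
      + k * (H m * ψ₀ + u₀ * Φ m) = 0) := by
  subst hm' hV hv₁ hv₂ hv₃
  have hu := smoothOn_polyJet t x u₀ u₁ u₂ u₃ a 0 0
  have hψ := smoothOn_polyJet t x ψ₀ w₁ w₂ w₃ b₀ b₁ (Complex.I * (k * (a * ψ₀ + u₀ * b₀)))
  obtain ⟨h1, h2⟩ := hX.2 _ _ (contDiffOn_univ.1 hu) (contDiffOn_univ.1 hψ) t x (by simpa [polyJet_self] using hm)
    (onShell_polyJet ha hb₀ hb₁)
  set u := polyJet t x u₀ u₁ u₂ u₃ a 0 0 with hu_def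
  set ψ := polyJet t x ψ₀ w₁ w₂ w₃ b₀ b₁ (Complex.I * (k * (a * ψ₀ + u₀ * b₀))) with hψ_def
  have hu0 : u t x = u₀ := polyJet_self ..
  have hψ0 : ψ t x = ψ₀ := polyJet_self ..
  have curve : ∀ {G : Type} [NormedAddCommGroup G] [NormedSpace ℝ G] {f : Space → G},
      ContDiffOn ℝ ∞ f D → HasJet (fun y => f (t, y, u t y, ψ t y)) x (f (t, x, u₀, ψ₀))
        (dirDeriv (0, 1, u₁, w₁) f (t, x, u₀, ψ₀))
        (jet₂ (0, 1, u₁, w₁) (0, 0, u₂, w₂) f (t, x, u₀, ψ₀))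
        (jet₃ (0, 1, u₁, w₁) (0, 0, u₂, w₂) (0, 0, u₃, w₃) f (t, x, u₀, ψ₀)) := by
    intro G _ _ f hf
    have h1 : ∀ y, HasDerivAt (fun y => ((t, y, u t y, ψ t y) : Space)) _ y := fun y =>
      (hasDerivAt_const y t).prodMk ((hasDerivAt_id y).prodMk
        ((hasDerivAt_polyJet_right ..).prodMk (hasDerivAt_polyJet_right ..)))
    have h2 : ∀ y, HasDerivAt (fun y => ((0, 1, polyJet t x u₁ u₂ u₃ 0 0 0 0 t y,
        polyJet t x w₁ w₂ w₃ 0 b₁ 0 0 t y) : Space)) _ y := fun y =>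
      (hasDerivAt_const y 0).prodMk ((hasDerivAt_const y 1).prodMk
        ((hasDerivAt_polyJet_right ..).prodMk (hasDerivAt_polyJet_right ..)))
    have h3 : HasDerivAt (fun y => ((0, 0, polyJet t x u₂ u₃ 0 0 0 0 0 t y,
        polyJet t x w₂ w₃ 0 0 0 0 0 t y) : Space)) _ x :=
      (hasDerivAt_const x 0).prodMk ((hasDerivAt_const x 0).prodMk
        ((hasDerivAt_polyJet_right ..).prodMk (hasDerivAt_polyJet_right ..)))
    have := hasJet_comp_curve hD hf h1 h2 h3 (by simpa only [hu0, hψ0] using hm)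
    simpa only [jet₂, jet₃, hu0, hψ0, polyJet_self] using this
  have timeCurve : ∀ {G : Type} [NormedAddCommGroup G] [NormedSpace ℝ G] {f : Space → G},
      ContDiffOn ℝ ∞ f D → HasDerivAt (fun s => f (s, x, u s x, ψ s x))
        (dirDeriv (1, 0, a, b₀) f (t, x, u₀, ψ₀)) t := by
    intro G _ _ f hf
    have h1 : HasDerivAt (fun s => ((s, x, u s x, ψ s x) : Space)) _ t :=
      (hasDerivAt_id t).prodMk ((hasDerivAt_const t x).prodMk
        ((hasDerivAt_polyJet_left ..).prodMk (hasDerivAt_polyJet_left ..)))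
    have := hasDerivAt_comp_curve hD hf h1 (by simpa only [hu0, hψ0] using hm)
    simpa only [hu0, hψ0, polyJet_self] using this
  have jT := curve hT
  have jZ := curve hZ
  have jH := curve hH
  have jΦ := curve hΦ
  have dT := timeCurve hT
  have dZ := timeCurve hZ
  have dH := timeCurve hH
  have dΦ := timeCurve hΦ
  unfold prKdv at h1
  unfold prLs at h2
  rw [prU_one_zero (X := field T Z H Φ) hu dT dZ dH, prU_zero_zero,
    prU_zero_one (X := field T Z H Φ) hu jT jZ jH,
    prU_zero_three (X := field T Z H Φ) hu jT jZ jH, prPsi_zero_zero,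
    prPsi_zero_one (X := field T Z H Φ) hψ jT jZ jΦ] at h1
  rw [prPsi_one_zero (X := field T Z H Φ) hψ dT dZ dΦ, prU_zero_zero,
    prPsi_zero_two (X := field T Z H Φ) hψ jT jZ jΦ, prPsi_zero_zero] at h2
  simp only [field, hu_def, hψ_def, Dx_polyJet, Dt_polyJet, polyJet_self] at h1 h2
  simp only [mul_zero, sub_zero] at h1
  exact ⟨h1, h2⟩

end JetCondition

/-! ### The determining equations -/

section Directions

variable {F : Type*} [NormedAddCommGroup F] [NormedSpace ℝ F]

/-- The direction of `t` in `Space`. -/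
def eT : Space := (1, 0, 0, 0)

/-- The direction of `x` in `Space`. -/
def eX : Space := (0, 1, 0, 0)

/-- The direction of `u` in `Space`. -/
def eU : Space := (0, 0, 1, 0)

/-- The direction of `q` in the `ψ`-plane of `Space`. -/
def ePsi (q : ℂ) : Space := (0, 0, 0, q)

lemma mk_eq (a b c : ℝ) (q : ℂ) :
    ((a, b, c, q) : Space) = a • eT + b • eX + c • eU + ePsi q := by
  simp [eT, eX, eU, ePsi]

lemma ePsi_add (q r : ℂ) : ePsi (q + r) = ePsi q + ePsi r := by simp [ePsi]

lemma ePsi_smul (c : ℝ) (q : ℂ) : ePsi (c * q) = c • ePsi q := by simp [ePsi]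

lemma ePsi_zero : ePsi 0 = 0 := rfl

lemma dirDeriv_zero_left (f : Space → F) (m : Space) : dirDeriv 0 f m = 0 := by simp [dirDeriv]

lemma dirDeriv_mk (a b c : ℝ) (q : ℂ) (f : Space → F) (m : Space) :
    dirDeriv (a, b, c, q) f m = a • dirDeriv eT f m + b • dirDeriv eX f m + c • dirDeriv eU f m
      + dirDeriv (ePsi q) f m := by
  rw [mk_eq]
  simp only [dirDeriv_add_left, dirDeriv_smul_left]

variable {D : Set Space} {f : Space → F} {t x u : ℝ} {ψ : ℂ}

lemma jet₂_eq_zero (hD : IsOpen D) {v₁ v₂ m : Space} (hm : m ∈ D)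
    (h₁ : ∀ m ∈ D, dirDeriv v₁ f m = 0) (h₂ : ∀ m ∈ D, dirDeriv v₂ f m = 0) :
    jet₂ v₁ v₂ f m = 0 := by
  rw [jet₂, dirDeriv_eq_zero hD h₁ hm, h₂ m hm, add_zero]

lemma jet₃_eq_zero (hD : IsOpen D) {v₁ v₂ v₃ m : Space} (hm : m ∈ D)
    (h₁ : ∀ m ∈ D, dirDeriv v₁ f m = 0) (h₂ : ∀ m ∈ D, dirDeriv v₂ f m = 0)
    (h₃ : ∀ m ∈ D, dirDeriv v₃ f m = 0) : jet₃ v₁ v₂ v₃ f m = 0 := by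
  rw [jet₃, dirDeriv_eq_zero hD (fun m hm => dirDeriv_eq_zero hD h₁ hm v₁) hm,
    dirDeriv_eq_zero hD h₂ hm, h₃ m hm]
  simp

/-- If `f` does not depend on `u` and `ψ`, then its third derivative along a curve with constant
`t` is the third `x`-derivative. -/
lemma jet₃_of_basic (hD : IsOpen D) (hf : ContDiffOn ℝ ∞ f D)
    (hu : ∀ m ∈ D, dirDeriv eU f m = 0) (hψ : ∀ q, ∀ m ∈ D, dirDeriv (ePsi q) f m = 0) {m : Space}
    (hm : m ∈ D) (c : ℝ) (w : ℂ) :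
    jet₃ (0, 1, c, w) 0 0 f m = dirDeriv eX (dirDeriv eX (dirDeriv eX f)) m := by
  have basic : ∀ g : Space → F, (∀ m ∈ D, dirDeriv eU g m = 0) →
      (∀ q, ∀ m ∈ D, dirDeriv (ePsi q) g m = 0) → ∀ m ∈ D,
        dirDeriv (0, 1, c, w) g m = dirDeriv eX g m := by
    intro g h1 h2 m hm
    rw [dirDeriv_mk, h1 m hm, h2 w m hm]
    simp
  have s1 := smoothOn_dirDeriv hD hf eX
  have b1 := basic f hu hψ
  have b2 := basic _ (dirDeriv_dirDeriv_eq_zero hD hf hu eX)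
    (fun q => dirDeriv_dirDeriv_eq_zero hD hf (hψ q) eX)
  have b3 := basic _ (dirDeriv_dirDeriv_eq_zero hD s1 (dirDeriv_dirDeriv_eq_zero hD hf hu eX) eX)
    (fun q => dirDeriv_dirDeriv_eq_zero hD s1 (dirDeriv_dirDeriv_eq_zero hD hf (hψ q) eX) eX)
  have c2 : ∀ m ∈ D, dirDeriv (0, 1, c, w) (dirDeriv (0, 1, c, w) f) m
      = dirDeriv eX (dirDeriv eX f) m :=
    fun m hm => (dirDeriv_congr hD b1 hm _).trans (b2 m hm)
  rw [jet₃, dirDeriv_zero_left, dirDeriv_congr hD c2 hm, b3 m hm,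
    dirDeriv_eq_zero hD (fun m _ => dirDeriv_zero_left f m) hm]
  simp

lemma hasDerivAt_along_x (hD : IsOpen D) (hf : ContDiffOn ℝ ∞ f D) (hm : (t, x, u, ψ) ∈ D) :
    HasDerivAt (fun y => f (t, y, u, ψ)) (dirDeriv eX f (t, x, u, ψ)) x :=
  hasDerivAt_comp_curve hD hf ((hasDerivAt_const x t).prodMk ((hasDerivAt_id x).prodMk
    ((hasDerivAt_const x u).prodMk (hasDerivAt_const x ψ)))) hm

lemma hasDerivAt_along_t (hD : IsOpen D) (hf : ContDiffOn ℝ ∞ f D) (hm : (t, x, u, ψ) ∈ D) :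
    HasDerivAt (fun s => f (s, x, u, ψ)) (dirDeriv eT f (t, x, u, ψ)) t :=
  hasDerivAt_comp_curve hD hf ((hasDerivAt_id t).prodMk ((hasDerivAt_const t x).prodMk
    ((hasDerivAt_const t u).prodMk (hasDerivAt_const t ψ)))) hm

lemma hasDerivAt_along_u (hD : IsOpen D) (hf : ContDiffOn ℝ ∞ f D) (hm : (t, x, u, ψ) ∈ D) :
    HasDerivAt (fun y => f (t, x, y, ψ)) (dirDeriv eU f (t, x, u, ψ)) u :=
  hasDerivAt_comp_curve hD hf ((hasDerivAt_const u t).prodMk ((hasDerivAt_const u x).prodMk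
    ((hasDerivAt_id u).prodMk (hasDerivAt_const u ψ)))) hm

lemma hasDerivAt_ofReal_add (ψ : ℂ) : HasDerivAt (fun y : ℝ => ψ + y) 1 0 :=
  (Complex.ofRealCLM.hasDerivAt (x := 0)).const_add ψ

lemma hasDerivAt_along_psi (hD : IsOpen D) (hf : ContDiffOn ℝ ∞ f D) (hm : (t, x, u, ψ) ∈ D) :
    HasDerivAt (fun y : ℝ => f (t, x, u, ψ + y)) (dirDeriv (ePsi 1) f (t, x, u, ψ)) 0 := by
  have := hasDerivAt_comp_curve hD hf (γ := fun y : ℝ => (t, x, u, ψ + y)) (y := 0)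
    ((hasDerivAt_const 0 t).prodMk ((hasDerivAt_const 0 x).prodMk
    ((hasDerivAt_const 0 u).prodMk (hasDerivAt_ofReal_add ψ)))) (by simpa using hm)
  simpa [ePsi] using this

lemma eventually_along_x (hD : IsOpen D) (hm : (t, x, u, ψ) ∈ D) :
    ∀ᶠ y in 𝓝 x, (t, y, u, ψ) ∈ D :=
  ContinuousAt.eventually_mem (f := fun y => ((t, y, u, ψ) : Space)) (by fun_prop) (hD.mem_nhds hm)

lemma eventually_along_t (hD : IsOpen D) (hm : (t, x, u, ψ) ∈ D) :
    ∀ᶠ y in 𝓝 t, (y, x, u, ψ) ∈ D :=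
  ContinuousAt.eventually_mem (f := fun y => ((y, x, u, ψ) : Space)) (by fun_prop) (hD.mem_nhds hm)

lemma eventually_along_u (hD : IsOpen D) (hm : (t, x, u, ψ) ∈ D) :
    ∀ᶠ y in 𝓝 u, (t, x, y, ψ) ∈ D :=
  ContinuousAt.eventually_mem (f := fun y => ((t, x, y, ψ) : Space)) (by fun_prop) (hD.mem_nhds hm)

lemma eventually_along_psi (hD : IsOpen D) (hm : (t, x, u, ψ) ∈ D) :
    ∀ᶠ y : ℝ in 𝓝 0, (t, x, u, ψ + y) ∈ D :=
  ContinuousAt.eventually_mem (f := fun y : ℝ => ((t, x, u, ψ + y) : Space)) (by fun_prop)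
    (hD.mem_nhds (by simpa using hm))

lemma eq_zero_of_hasDerivAt {g : ℝ → F} {c : F} {y : ℝ} (h : HasDerivAt g c y)
    (h0 : ∀ᶠ s in 𝓝 y, g s = 0) : c = 0 :=
  h.unique ((hasDerivAt_const y (0 : F)).congr_of_eventuallyEq h0)

lemma exists_eq_const (hD : IsOpen D) (hc : IsPreconnected D) (hne : D.Nonempty)
    (hf : ContDiffOn ℝ ∞ f D) (ht : ∀ m ∈ D, dirDeriv eT f m = 0)
    (hx : ∀ m ∈ D, dirDeriv eX f m = 0) (hu : ∀ m ∈ D, dirDeriv eU f m = 0)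
    (hψ : ∀ q, ∀ m ∈ D, dirDeriv (ePsi q) f m = 0) : ∃ c, ∀ m ∈ D, f m = c := by
  obtain ⟨m₀, hm₀⟩ := hne
  refine ⟨f m₀, fun m hm => hD.is_const_of_fderiv_eq_zero hc
    (fun m hm => (differentiableAt_of_smoothOn hD hf hm).differentiableWithinAt) ?_ hm hm₀⟩
  intro m hm
  refine ContinuousLinearMap.ext fun ⟨a, b, c, q⟩ => ?_
  change dirDeriv (a, b, c, q) f m = 0
  rw [dirDeriv_mk, ht m hm, hx m hm, hu m hm, hψ q m hm]
  simp

end Directions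

/-- `T ∂_t + Z ∂_x + H ∂_u + Φ ∂_ψ + conj Φ ∂_{conj ψ}` has smooth components and generates point
symmetries on the open set `D`. -/
structure IsSymmetryField (p s₁ s₂ k : ℝ) (D : Set Space) (T Z H : Space → ℝ) (Φ : Space → ℂ) :
    Prop where
  isOpen : IsOpen D
  smooth_T : ContDiffOn ℝ ∞ T D
  smooth_Z : ContDiffOn ℝ ∞ Z D
  smooth_H : ContDiffOn ℝ ∞ H D
  smooth_Φ : ContDiffOn ℝ ∞ Φ D
  symm : IsPointSymmetry p s₁ s₂ k D (field T Z H Φ)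

namespace IsSymmetryField

variable {p s₁ s₂ k : ℝ} {D : Set Space} {T Z H : Space → ℝ} {Φ : Space → ℂ}

/-- `τ` depends on `t` only: the coefficient of `ψ_xxx` in the second equation is
`-2 i D_x τ`. -/
lemma dirDeriv_T_vertical (h : IsSymmetryField p s₁ s₂ k D T Z H Φ) {m : Space} (hm : m ∈ D)
    (b c : ℝ) (q : ℂ) : dirDeriv (0, b, c, q) T m = 0 := by
  have key : ∀ c q, dirDeriv (0, 1, c, q) T m = 0 := by
    intro c q
    obtain ⟨t, x, u, ψ⟩ := m
    have e := fun w₃ => (h.symm.jet_condition h.isOpen h.smooth_T h.smooth_Z h.smooth_H h.smooth_Φ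
      hm c 0 0 q 0 w₃ rfl rfl rfl rfl rfl rfl rfl rfl).2
    have e₁ := e 1
    have e₀ := e 0
    have : ((dirDeriv (0, 1, c, q) T (t, x, u, ψ) : ℝ) : ℂ) = 0 := by
      generalize dirDeriv (0, 1, c, q) T (t, x, u, ψ) = d at e₁ e₀ ⊢
      linear_combination (Complex.I / 2) * (e₁ - e₀) + d * Complex.I_mul_I
    exact_mod_cast this
  have : ((0, b, c, q) : Space) = (0, 1, c, q) + (b - 1) • (0, 1, 0, 0) := by simp
  rw [this, dirDeriv_add_left, dirDeriv_smul_left, key, key]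
  simp

lemma dirDeriv_T (h : IsSymmetryField p s₁ s₂ k D T Z H Φ) {m : Space} (hm : m ∈ D)
    (a b c : ℝ) (q : ℂ) : dirDeriv (a, b, c, q) T m = a * dirDeriv eT T m := by
  have h1 := dirDeriv_mk a b c q T m
  have h2 := dirDeriv_mk 0 b c q T m
  rw [h.dirDeriv_T_vertical hm] at h2
  rw [h1, add_assoc, add_assoc, ← add_assoc (b • _)]
  simp only [zero_smul, zero_add] at h2
  rw [← h2]
  simp

/-- The symmetry condition of the second equation, once `τ` is known to depend on `t` only. -/
lemma ls_condition (h : IsSymmetryField p s₁ s₂ k D T Z H Φ) {t x u : ℝ} {ψ : ℂ}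
    (hm : (t, x, u, ψ) ∈ D) (u₁ u₂ u₃ : ℝ) (w₁ w₂ : ℂ)
    {a : ℝ} {b₀ : ℂ} (ha : a = -(s₁ * u ^ p * u₁ + u₃ + s₂ * (2 * (conj ψ * w₁).re)))
    (hb₀ : b₀ = Complex.I * (w₂ + k * u * ψ)) {m : Space} (hm' : m = (t, x, u, ψ)) :
    Complex.I * (dirDeriv (1, 0, a, b₀) Φ m - dirDeriv eT T m * b₀
        - dirDeriv (1, 0, a, b₀) Z m * w₁)
      + (jet₂ (0, 1, u₁, w₁) (0, 0, u₂, w₂) Φ m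
        - jet₂ (0, 1, u₁, w₁) (0, 0, u₂, w₂) Z m * w₁
        - 2 * dirDeriv (0, 1, u₁, w₁) Z m * w₂)
      + k * (H m * ψ + u * Φ m) = 0 := by
  subst hm'
  have e := (h.symm.jet_condition h.isOpen h.smooth_T h.smooth_Z h.smooth_H h.smooth_Φ
    hm u₁ u₂ u₃ w₁ w₂ 0 ha hb₀ rfl rfl rfl rfl rfl rfl).2
  rw [jet₂_eq_zero h.isOpen hm (fun m hm => h.dirDeriv_T_vertical hm _ _ _)
    (fun m hm => h.dirDeriv_T_vertical hm _ _ _), h.dirDeriv_T_vertical hm, h.dirDeriv_T hm] at e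
  rw [← e]
  push_cast
  ring

/-- The symmetry condition of the first equation, once `τ` is known to depend on `t` only. -/
lemma kdv_condition (h : IsSymmetryField p s₁ s₂ k D T Z H Φ) {t x u : ℝ} {ψ : ℂ}
    (hm : (t, x, u, ψ) ∈ D) (u₁ u₂ u₃ : ℝ) (w₁ w₂ w₃ : ℂ)
    {a : ℝ} {b₀ : ℂ} (ha : a = -(s₁ * u ^ p * u₁ + u₃ + s₂ * (2 * (conj ψ * w₁).re)))
    (hb₀ : b₀ = Complex.I * (w₂ + k * u * ψ)) {m : Space} (hm' : m = (t, x, u, ψ)) :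
    dirDeriv (1, 0, a, b₀) H m - dirDeriv eT T m * a - dirDeriv (1, 0, a, b₀) Z m * u₁
      + s₁ * (p * u ^ (p - 1) * H m * u₁
        + u ^ p * (dirDeriv (0, 1, u₁, w₁) H m - dirDeriv (0, 1, u₁, w₁) Z m * u₁))
      + (jet₃ (0, 1, u₁, w₁) (0, 0, u₂, w₂) (0, 0, u₃, w₃) H m
        - jet₃ (0, 1, u₁, w₁) (0, 0, u₂, w₂) (0, 0, u₃, w₃) Z m * u₁
        - 3 * jet₂ (0, 1, u₁, w₁) (0, 0, u₂, w₂) Z m * u₂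
        - 3 * dirDeriv (0, 1, u₁, w₁) Z m * u₃)
      + s₂ * (2 * (conj (Φ m) * w₁ + conj ψ *
        (dirDeriv (0, 1, u₁, w₁) Φ m - dirDeriv (0, 1, u₁, w₁) Z m * w₁)).re) = 0 := by
  subst hm'
  have e := (h.symm.jet_condition h.isOpen h.smooth_T h.smooth_Z h.smooth_H h.smooth_Φ
    hm u₁ u₂ u₃ w₁ w₂ w₃ ha hb₀ rfl rfl rfl rfl rfl rfl).1
  rw [jet₃_eq_zero h.isOpen hm (fun m hm => h.dirDeriv_T_vertical hm _ _ _)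
    (fun m hm => h.dirDeriv_T_vertical hm _ _ _) (fun m hm => h.dirDeriv_T_vertical hm _ _ _),
    h.dirDeriv_T_vertical hm, h.dirDeriv_T hm] at e
  simpa only [one_mul, zero_mul, sub_zero, Complex.ofReal_zero] using e

/-- `ξ` and `φ` do not depend on `u`, because `u_t` enters the second equation through `D_t φ` and
`D_t ξ` only, and can be varied together with `u_xxx` without leaving the solution jets. -/
lemma dirDeriv_eU_ΦZ (h : IsSymmetryField p s₁ s₂ k D T Z H Φ) {m : Space} (hm : m ∈ D) :
    dirDeriv eU Φ m = 0 ∧ dirDeriv eU Z m = 0 := by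
  obtain ⟨t, x, u, ψ⟩ := m
  have key : ∀ w : ℂ,
      dirDeriv eU Φ (t, x, u, ψ) - ((dirDeriv eU Z (t, x, u, ψ) : ℝ) : ℂ) * w = 0 := by
    intro w
    have e1 := h.ls_condition hm 0 0 1 w 0 rfl rfl rfl
    have e0 := h.ls_condition hm 0 0 0 w 0 rfl rfl rfl
    simp only [dirDeriv_mk 1, smul_eq_mul, Complex.real_smul] at e1 e0
    push_cast at e1 e0
    linear_combination Complex.I * (e1 - e0) + (dirDeriv eU Φ (t, x, u, ψ)
      - ((dirDeriv eU Z (t, x, u, ψ) : ℝ) : ℂ) * w) * Complex.I_mul_I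
  have k0 := key 0
  have k1 := key 1
  simp only [mul_zero, sub_zero] at k0
  rw [k0] at k1
  exact ⟨k0, by simpa using k1⟩

/-- The part of the second equation that is linear in `q = ψ_xx`, at `ψ_x = r`. -/
lemma psi_xx_condition (h : IsSymmetryField p s₁ s₂ k D T Z H Φ) {m : Space} (hm : m ∈ D)
    (q r : ℂ) :
    Complex.I * (dirDeriv (ePsi (Complex.I * q)) Φ m - dirDeriv eT T m * (Complex.I * q)
        - dirDeriv (ePsi (Complex.I * q)) Z m * r)
      + (dirDeriv (ePsi q) Φ m - dirDeriv (ePsi q) Z m * r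
        - 2 * (dirDeriv eX Z m + dirDeriv (ePsi r) Z m) * q) = 0 := by
  obtain ⟨t, x, u, ψ⟩ := m
  have e1 := h.ls_condition hm 0 0 0 r q (b₀ := Complex.I * q + Complex.I * (k * u * ψ)) rfl
    (by ring) rfl
  have e0 := h.ls_condition hm 0 0 0 r 0 (b₀ := Complex.I * (k * u * ψ)) rfl (by ring) rfl
  simp only [jet₂, dirDeriv_mk 1, dirDeriv_mk 0 0, ePsi_add, dirDeriv_add_left, ePsi_zero,
    dirDeriv_zero_left] at e1 e0
  rw [dirDeriv_mk 0 1 0 r Z] at e1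
  simp only [smul_eq_mul, Complex.real_smul] at e1 e0
  push_cast at e1 e0
  linear_combination e1 - e0

/-- `ξ` does not depend on `ψ`: this is the part of `psi_xx_condition` that is bilinear in
`q = ψ_xx` and `r = ψ_x`. -/
lemma dirDeriv_ePsi_Z (h : IsSymmetryField p s₁ s₂ k D T Z H Φ) {m : Space} (hm : m ∈ D) (q : ℂ) :
    dirDeriv (ePsi q) Z m = 0 := by
  rcases eq_or_ne q 0 with rfl | hq
  · rw [ePsi_zero, dirDeriv_zero_left]
  have e1 := h.psi_xx_condition hm q q
  have e0 := h.psi_xx_condition hm q 0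
  rw [ePsi_zero, dirDeriv_zero_left] at e0
  push_cast at e0
  have e : q * (((dirDeriv (ePsi (Complex.I * q)) Z m : ℝ) : ℂ) * Complex.I
      + 3 * (dirDeriv (ePsi q) Z m : ℝ)) = 0 := by
    linear_combination e0 - e1
  have e' := congrArg Complex.re ((mul_eq_zero.1 e).resolve_left hq)
  simpa using e'

/-- The second equation forces the scaling weights of `t` and `x` to be in the ratio `2 : 1`. -/
lemma dirDeriv_eT_T_eq_two (h : IsSymmetryField p s₁ s₂ k D T Z H Φ) {m : Space} (hm : m ∈ D) :
    dirDeriv eT T m = 2 * dirDeriv eX Z m := by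
  have e0 := h.psi_xx_condition hm 1 0
  have e1 := h.psi_xx_condition hm Complex.I 0
  have hneg : dirDeriv (ePsi (Complex.I * Complex.I)) Φ m = -dirDeriv (ePsi 1) Φ m := by
    have : ePsi (Complex.I * Complex.I) = (-1 : ℝ) • ePsi 1 := by simp [ePsi]
    rw [this, dirDeriv_smul_left]
    simp
  simp only [ePsi_zero, dirDeriv_zero_left, hneg, mul_one] at e0 e1
  push_cast at e0 e1
  have : ((dirDeriv eT T m : ℝ) : ℂ) = 2 * (dirDeriv eX Z m : ℝ) := by
    generalize dirDeriv eT T m = τ at e0 e1 ⊢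
    generalize dirDeriv eX Z m = ζ at e0 e1 ⊢
    linear_combination (1 / 2) * e0 - (Complex.I / 2) * e1
      + (-dirDeriv (ePsi 1) Φ m / 2 + τ * (1 - Complex.I ^ 2 / 2) - ζ) * Complex.I_mul_I
  exact_mod_cast this

/-- `φ` depends complex linearly on `ψ` to first order. -/
lemma dirDeriv_ePsi_Φ (h : IsSymmetryField p s₁ s₂ k D T Z H Φ) {m : Space} (hm : m ∈ D) (q : ℂ) :
    dirDeriv (ePsi q) Φ m = q * dirDeriv (ePsi 1) Φ m := by
  have e0 := h.psi_xx_condition hm 1 0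
  simp only [ePsi_zero, dirDeriv_zero_left, mul_one, h.dirDeriv_eT_T_eq_two hm] at e0
  push_cast at e0
  have hI : dirDeriv (ePsi Complex.I) Φ m = Complex.I * dirDeriv (ePsi 1) Φ m := by
    linear_combination (-Complex.I) * e0 + (dirDeriv (ePsi Complex.I) Φ m
      - 2 * (dirDeriv eX Z m : ℝ) * Complex.I) * Complex.I_mul_I
  have hq : ePsi q = q.re • ePsi 1 + q.im • ePsi Complex.I := by
    rw [← ePsi_smul, ← ePsi_smul, ← ePsi_add]
    simp [Complex.re_add_im]
  rw [hq, dirDeriv_add_left, dirDeriv_smul_left, dirDeriv_smul_left, hI]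
  simp only [Complex.real_smul]
  linear_combination dirDeriv (ePsi 1) Φ m * Complex.re_add_im q

/-- The first equation forces the scaling weights of `t` and `x` to be in the ratio `3 : 1`: this is
the coefficient of `u_xxx`. -/
lemma dirDeriv_eT_T_eq_three (h : IsSymmetryField p s₁ s₂ k D T Z H Φ) {m : Space} (hm : m ∈ D) :
    dirDeriv eT T m = 3 * dirDeriv eX Z m := by
  obtain ⟨t, x, u, ψ⟩ := m
  have e1 := h.kdv_condition hm 0 0 1 0 0 0 rfl rfl rfl
  have e0 := h.kdv_condition hm 0 0 0 0 0 0 rfl rfl rfl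
  simp only [jet₃] at e1 e0
  simp only [dirDeriv_mk 1, dirDeriv_mk 0 1, dirDeriv_mk 0 0 1, dirDeriv_mk 0 0 0 0 H, ePsi_zero,
    dirDeriv_zero_left, smul_eq_mul] at e1 e0
  linear_combination e1 - e0

lemma dirDeriv_eX_Z (h : IsSymmetryField p s₁ s₂ k D T Z H Φ) {m : Space} (hm : m ∈ D) :
    dirDeriv eX Z m = 0 := by
  linarith [h.dirDeriv_eT_T_eq_two hm, h.dirDeriv_eT_T_eq_three hm]

lemma dirDeriv_eT_T (h : IsSymmetryField p s₁ s₂ k D T Z H Φ) {m : Space} (hm : m ∈ D) :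
    dirDeriv eT T m = 0 := by
  linarith [h.dirDeriv_eT_T_eq_two hm, h.dirDeriv_eT_T_eq_three hm]

/-- `η` does not depend on `ψ`: this is the coefficient of `ψ_xxx` in the first equation. -/
lemma dirDeriv_ePsi_H (h : IsSymmetryField p s₁ s₂ k D T Z H Φ) {m : Space} (hm : m ∈ D) (q : ℂ) :
    dirDeriv (ePsi q) H m = 0 := by
  obtain ⟨t, x, u, ψ⟩ := m
  have e1 := h.kdv_condition hm 0 0 0 0 0 q rfl rfl rfl
  have e0 := h.kdv_condition hm 0 0 0 0 0 0 rfl rfl rfl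
  simp only [jet₃, dirDeriv_mk 0 0 0 q H] at e1 e0
  rw [dirDeriv_mk 0 0 0 0 H, ePsi_zero, dirDeriv_zero_left] at e0
  simp only [zero_smul] at e1 e0
  linear_combination e1 - e0

lemma dirDeriv_Z (h : IsSymmetryField p s₁ s₂ k D T Z H Φ) {m : Space} (hm : m ∈ D)
    (a b c : ℝ) (q : ℂ) : dirDeriv (a, b, c, q) Z m = a * dirDeriv eT Z m := by
  rw [dirDeriv_mk, h.dirDeriv_eX_Z hm, (h.dirDeriv_eU_ΦZ hm).2, h.dirDeriv_ePsi_Z hm]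
  simp

end IsSymmetryField

/-- On `powDomain p` a negative base occurs with an integer exponent only; for other exponents the
convention for real powers of negative numbers allows the value `0`. -/
lemma rpow_sub_ne_zero {p u : ℝ} (hu : u ∈ powDomain p) (h0 : u ≠ 0) : u ^ (p - 1 - 1) ≠ 0 := by
  have int : ∀ n : ℤ, p = n → u ^ (p - 1 - 1) ≠ 0 := by
    rintro n rfl
    have : (n : ℝ) - 1 - 1 = ((n - 1 - 1 : ℤ) : ℝ) := by push_cast; ring
    rw [this, Real.rpow_intCast]
    exact zpow_ne_zero _ h0
  rcases hu with ⟨n, hn⟩ | ⟨⟨n, hn⟩, -⟩ | h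
  · exact int n (by simpa using hn)
  · exact int n hn
  · exact (Real.rpow_pos_of_pos h _).ne'

namespace IsSymmetryField

variable {p s₁ s₂ k : ℝ} {D : Set Space} {T Z H : Space → ℝ} {Φ : Space → ℂ}

/-- The second equation for jets with `ψ_xx = ψ_xxx = 0` and `u_x = u_xx = u_xxx = 0`, as a
polynomial in `w = ψ_x`. -/
lemma psi_x_condition (h : IsSymmetryField p s₁ s₂ k D T Z H Φ) {t x u : ℝ} {ψ : ℂ}
    (hm : (t, x, u, ψ) ∈ D) (w : ℂ) {m : Space} (hm' : m = (t, x, u, ψ)) :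
    Complex.I * dirDeriv eT Φ m - k * u * ψ * dirDeriv (ePsi 1) Φ m + dirDeriv eX (dirDeriv eX Φ) m
      + k * (H m * ψ + u * Φ m)
      + w * (2 * dirDeriv eX (dirDeriv (ePsi 1) Φ) m - Complex.I * dirDeriv eT Z m
        + dirDeriv (ePsi w) (dirDeriv (ePsi 1) Φ) m) = 0 := by
  have hD := h.isOpen
  have hA := smoothOn_dirDeriv hD h.smooth_Φ (ePsi 1)
  have e := h.ls_condition hm 0 0 0 w 0 (b₀ := Complex.I * (k * u * ψ)) rfl (by ring) hm'
  subst hm'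
  have hw : ∀ v, dirDeriv v (dirDeriv (ePsi w) Φ) (t, x, u, ψ)
      = w * dirDeriv v (dirDeriv (ePsi 1) Φ) (t, x, u, ψ) := by
    intro v
    rw [dirDeriv_congr hD (fun m hm => h.dirDeriv_ePsi_Φ hm w) hm]
    exact dirDeriv_clm_comp hD hA hm (ContinuousLinearMap.mul ℝ ℂ w) v
  have hvec : ((0, 1, 0, w) : Space) = eX + ePsi w := by simp [eX, ePsi]
  have hj : jet₂ (0, 1, 0, w) (0, 0, 0, 0) Φ (t, x, u, ψ) = dirDeriv eX (dirDeriv eX Φ) (t, x, u, ψ)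
      + 2 * w * dirDeriv eX (dirDeriv (ePsi 1) Φ) (t, x, u, ψ)
      + w * dirDeriv (ePsi w) (dirDeriv (ePsi 1) Φ) (t, x, u, ψ) := by
    have h0 : ((0, 0, 0, 0) : Space) = 0 := rfl
    rw [jet₂, h0, dirDeriv_zero_left, hvec, dirDeriv_dirDeriv_add hD h.smooth_Φ hm,
      dirDeriv_add_left, dirDeriv_add_left, dirDeriv_comm hD h.smooth_Φ hm (ePsi w) eX, hw, hw]
    ring
  have hj' : jet₂ (0, 1, 0, w) (0, 0, 0, 0) Z (t, x, u, ψ) = 0 :=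
    jet₂_eq_zero hD hm (fun m hm => by rw [h.dirDeriv_Z hm, zero_mul])
      (fun m hm => by rw [h.dirDeriv_Z hm, zero_mul])
  rw [hj, hj', h.dirDeriv_Z hm, h.dirDeriv_eT_T hm, dirDeriv_mk, h.dirDeriv_ePsi_Φ hm,
    (h.dirDeriv_eU_ΦZ hm).1] at e
  simp only [Complex.real_smul, smul_zero] at e
  push_cast at e
  linear_combination e + (-k * u * ψ * dirDeriv (ePsi 1) Φ (t, x, u, ψ)) * Complex.I_mul_I

/-- The derivative of `φ` with respect to `ψ` does not depend on `ψ`, and its `x`-derivative is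
determined by `ξ`. -/
lemma dirDeriv_A (h : IsSymmetryField p s₁ s₂ k D T Z H Φ) {m : Space} (hm : m ∈ D) :
    (∀ q, dirDeriv (ePsi q) (dirDeriv (ePsi 1) Φ) m = 0) ∧
      2 * dirDeriv eX (dirDeriv (ePsi 1) Φ) m = Complex.I * dirDeriv eT Z m := by
  obtain ⟨t, x, u, ψ⟩ := m
  have e0 := h.psi_x_condition hm 0 rfl
  have key : ∀ w : ℂ, w ≠ 0 → 2 * dirDeriv eX (dirDeriv (ePsi 1) Φ) (t, x, u, ψ)
      - Complex.I * dirDeriv eT Z (t, x, u, ψ)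
      + dirDeriv (ePsi w) (dirDeriv (ePsi 1) Φ) (t, x, u, ψ) = 0 := by
    intro w hw
    have e1 := h.psi_x_condition hm w rfl
    refine (mul_eq_zero.1 (?_ : w * _ = 0)).resolve_left hw
    linear_combination e1 - e0
  have hneg : ∀ w : ℂ, dirDeriv (ePsi (-w)) (dirDeriv (ePsi 1) Φ) (t, x, u, ψ)
      = -dirDeriv (ePsi w) (dirDeriv (ePsi 1) Φ) (t, x, u, ψ) := by
    intro w
    have : ePsi (-w) = (-1 : ℝ) • ePsi w := by simp [ePsi]
    rw [this, dirDeriv_smul_left]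
    simp
  constructor
  · intro q
    rcases eq_or_ne q 0 with rfl | hq
    · rw [ePsi_zero, dirDeriv_zero_left]
    · have k1 := key q hq
      have k2 := key (-q) (neg_ne_zero.2 hq)
      rw [hneg] at k2
      linear_combination (k1 - k2) / 2
  · have k1 := key 1 one_ne_zero
    have k2 := key (-1) (neg_ne_zero.2 one_ne_zero)
    rw [hneg] at k2
    linear_combination (k1 + k2) / 2

lemma dirDeriv_eU_A (h : IsSymmetryField p s₁ s₂ k D T Z H Φ) {m : Space} (hm : m ∈ D) :
    dirDeriv eU (dirDeriv (ePsi 1) Φ) m = 0 :=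
  dirDeriv_dirDeriv_eq_zero h.isOpen h.smooth_Φ (fun _ hm => (h.dirDeriv_eU_ΦZ hm).1) _ m hm

lemma smooth_A (h : IsSymmetryField p s₁ s₂ k D T Z H Φ) :
    ContDiffOn ℝ ∞ (dirDeriv (ePsi 1) Φ) D := smoothOn_dirDeriv h.isOpen h.smooth_Φ _

/-- The part of the second equation of order zero in `ψ_x`. -/
lemma ls_remainder (h : IsSymmetryField p s₁ s₂ k D T Z H Φ) {t x u : ℝ} {ψ : ℂ}
    (hm : (t, x, u, ψ) ∈ D) :
    Complex.I * dirDeriv eT Φ (t, x, u, ψ) - k * u * ψ * dirDeriv (ePsi 1) Φ (t, x, u, ψ)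
      + dirDeriv eX (dirDeriv eX Φ) (t, x, u, ψ)
      + k * (H (t, x, u, ψ) * ψ + u * Φ (t, x, u, ψ)) = 0 := by
  have e0 := h.psi_x_condition hm 0 rfl
  linear_combination e0

/-- The `u`-derivative of `ls_remainder`. -/
lemma Φ_eq_sub (h : IsSymmetryField p s₁ s₂ k D T Z H Φ) (hk : k ≠ 0) {t x u : ℝ} {ψ : ℂ}
    (hm : (t, x, u, ψ) ∈ D) :
    Φ (t, x, u, ψ) - dirDeriv (ePsi 1) Φ (t, x, u, ψ) * ψ + dirDeriv eU H (t, x, u, ψ) * ψ = 0 := by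
  have hD := h.isOpen
  have hU := fun m hm => (h.dirDeriv_eU_ΦZ (m := m) hm).1
  have s1 := smoothOn_dirDeriv hD h.smooth_Φ eX
  have d1 := hasDerivAt_along_u hD (smoothOn_dirDeriv hD h.smooth_Φ eT) hm
  have d2 := hasDerivAt_along_u hD h.smooth_A hm
  have d3 := hasDerivAt_along_u hD (smoothOn_dirDeriv hD s1 eX) hm
  have d4 := (hasDerivAt_along_u hD h.smooth_H hm).ofReal_comp
  have d5 := hasDerivAt_along_u hD h.smooth_Φ hm
  rw [dirDeriv_dirDeriv_eq_zero hD h.smooth_Φ hU eT _ hm] at d1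
  rw [h.dirDeriv_eU_A hm] at d2
  rw [dirDeriv_dirDeriv_eq_zero hD s1 (dirDeriv_dirDeriv_eq_zero hD h.smooth_Φ hU eX) eX _ hm] at d3
  rw [hU _ hm] at d5
  have du : HasDerivAt (fun y : ℝ => (y : ℂ)) 1 u := (hasDerivAt_id u).ofReal_comp
  have e := eq_zero_of_hasDerivAt
    (((((d1.const_mul Complex.I).sub (((du.const_mul (k : ℂ)).mul_const ψ).mul d2)).add d3).add
      (((d4.mul_const ψ).add (du.mul d5)).const_mul (k : ℂ))))
    ((eventually_along_u hD hm).mono fun y hy => h.ls_remainder hy)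
  have hk' : (k : ℂ) ≠ 0 := by exact_mod_cast hk
  refine (mul_eq_zero.1 (?_ : (k : ℂ) * _ = 0)).resolve_left hk'
  linear_combination e

/-- `η` does not depend on `u`. -/
lemma dirDeriv_eU_H (h : IsSymmetryField p s₁ s₂ k D T Z H Φ) (hk : k ≠ 0) {m : Space}
    (hm : m ∈ D) : dirDeriv eU H m = 0 := by
  obtain ⟨t, x, u, ψ⟩ := m
  have hD := h.isOpen
  have d1 := hasDerivAt_along_psi hD h.smooth_Φ hm
  have d2 := hasDerivAt_along_psi hD h.smooth_A hm
  have d3 := (hasDerivAt_along_psi hD (smoothOn_dirDeriv hD h.smooth_H eU) hm).ofReal_comp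
  rw [(h.dirDeriv_A hm).1] at d2
  rw [dirDeriv_dirDeriv_eq_zero hD h.smooth_H (fun m hm => h.dirDeriv_ePsi_H hm 1) eU _ hm] at d3
  have dψ := hasDerivAt_ofReal_add ψ
  have e := eq_zero_of_hasDerivAt ((d1.sub (d2.mul dψ)).add (d3.mul dψ))
    ((eventually_along_psi hD hm).mono fun y hy => h.Φ_eq_sub hk hy)
  simp only [Complex.ofReal_zero, add_zero] at e
  have : ((dirDeriv eU H (t, x, u, ψ) : ℝ) : ℂ) = 0 := by linear_combination e
  exact_mod_cast this

/-- `φ` is complex linear in `ψ`. -/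
lemma Φ_eq (h : IsSymmetryField p s₁ s₂ k D T Z H Φ) (hk : k ≠ 0) {t x u : ℝ} {ψ : ℂ}
    (hm : (t, x, u, ψ) ∈ D) : Φ (t, x, u, ψ) = dirDeriv (ePsi 1) Φ (t, x, u, ψ) * ψ := by
  have e := h.Φ_eq_sub hk hm
  rw [h.dirDeriv_eU_H hk hm] at e
  push_cast at e
  linear_combination e

lemma dirDeriv_eX_Φ (h : IsSymmetryField p s₁ s₂ k D T Z H Φ) (hk : k ≠ 0) {t x u : ℝ} {ψ : ℂ}
    (hm : (t, x, u, ψ) ∈ D) :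
    dirDeriv eX Φ (t, x, u, ψ) = Complex.I / 2 * dirDeriv eT Z (t, x, u, ψ) * ψ := by
  have hD := h.isOpen
  have e := eq_zero_of_hasDerivAt
    ((hasDerivAt_along_x hD h.smooth_Φ hm).sub ((hasDerivAt_along_x hD h.smooth_A hm).mul_const ψ))
    ((eventually_along_x hD hm).mono fun y hy => sub_eq_zero.2 (h.Φ_eq hk hy))
  linear_combination e + ψ / 2 * (h.dirDeriv_A hm).2

lemma dirDeriv_eX_eT_Z (h : IsSymmetryField p s₁ s₂ k D T Z H Φ) {m : Space} (hm : m ∈ D) :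
    dirDeriv eX (dirDeriv eT Z) m = 0 :=
  dirDeriv_dirDeriv_eq_zero h.isOpen h.smooth_Z (fun _ hm => h.dirDeriv_eX_Z hm) _ m hm

/-- The `t`-derivative of the coefficient `φ / ψ`. -/
lemma dirDeriv_eT_A (h : IsSymmetryField p s₁ s₂ k D T Z H Φ) (hk : k ≠ 0) {m : Space}
    (hm : m ∈ D) : dirDeriv eT (dirDeriv (ePsi 1) Φ) m = Complex.I * (k * H m) := by
  have hD := h.isOpen
  have key : ∀ {t x u : ℝ} {ψ : ℂ}, (t, x, u, ψ) ∈ D →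
      (Complex.I * dirDeriv eT (dirDeriv (ePsi 1) Φ) (t, x, u, ψ) + k * H (t, x, u, ψ)) * ψ
        = 0 := by
    intro t x u ψ hm
    have e1 := eq_zero_of_hasDerivAt
      ((hasDerivAt_along_t hD h.smooth_Φ hm).sub
        ((hasDerivAt_along_t hD h.smooth_A hm).mul_const ψ))
      ((eventually_along_t hD hm).mono fun y hy => sub_eq_zero.2 (h.Φ_eq hk hy))
    have e2 := eq_zero_of_hasDerivAt
      ((hasDerivAt_along_x hD (smoothOn_dirDeriv hD h.smooth_Φ eX) hm).sub
        ((((hasDerivAt_along_x hD (smoothOn_dirDeriv hD h.smooth_Z eT) hm).ofReal_comp).const_mul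
          (Complex.I / 2)).mul_const ψ))
      ((eventually_along_x hD hm).mono fun y hy => sub_eq_zero.2 (h.dirDeriv_eX_Φ hk hy))
    rw [h.dirDeriv_eX_eT_Z hm] at e2
    push_cast at e2
    have e3 := h.ls_remainder hm
    linear_combination e3 - Complex.I * e1 - e2 - k * u * h.Φ_eq hk hm
  -- the factor `ψ` is removed by differentiating with respect to `ψ`, which also covers `ψ = 0`
  obtain ⟨t, x, u, ψ⟩ := m
  have d1 := hasDerivAt_along_psi hD (smoothOn_dirDeriv hD h.smooth_A eT) hm
  have d2 := (hasDerivAt_along_psi hD h.smooth_H hm).ofReal_comp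
  rw [dirDeriv_dirDeriv_eq_zero hD h.smooth_A (fun m hm => (h.dirDeriv_A hm).1 1) eT _ hm] at d1
  rw [h.dirDeriv_ePsi_H hm] at d2
  have e := eq_zero_of_hasDerivAt
    (((d1.const_mul Complex.I).add (d2.const_mul (k : ℂ))).mul (hasDerivAt_ofReal_add ψ))
    ((eventually_along_psi hD hm).mono fun y hy => key hy)
  simp only [Pi.add_apply, Complex.ofReal_zero, add_zero] at e
  linear_combination -Complex.I * e
    + dirDeriv eT (dirDeriv (ePsi 1) Φ) (t, x, u, ψ) * Complex.I_mul_I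

/-- The first equation for jets with `u_xx = u_xxx = 0` and `ψ_xx = ψ_xxx = 0`, as a polynomial in
`c = u_x` and `w = ψ_x`. -/
lemma u_x_condition (h : IsSymmetryField p s₁ s₂ k D T Z H Φ) (hk : k ≠ 0) {t x u : ℝ} {ψ : ℂ}
    (hm : (t, x, u, ψ) ∈ D) (c : ℝ) (w : ℂ) {m : Space} (hm' : m = (t, x, u, ψ)) :
    dirDeriv eT H m + s₁ * u ^ p * dirDeriv eX H m + dirDeriv eX (dirDeriv eX (dirDeriv eX H)) m
      + c * (s₁ * (p * u ^ (p - 1) * H m) - dirDeriv eT Z m)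
      + 4 * s₂ * (dirDeriv (ePsi 1) Φ m).re * (conj ψ * w).re = 0 := by
  have hD := h.isOpen
  have e := h.kdv_condition hm c 0 0 w 0 0 rfl rfl hm'
  subst hm'
  have hZ3 : jet₃ (0, 1, c, w) (0, 0, 0, 0) (0, 0, 0, 0) Z (t, x, u, ψ) = 0 :=
    jet₃_eq_zero hD hm (fun m hm => by rw [h.dirDeriv_Z hm, zero_mul])
      (fun m hm => by rw [h.dirDeriv_Z hm, zero_mul])
      (fun m hm => by rw [h.dirDeriv_Z hm, zero_mul])
  have hH3 : jet₃ (0, 1, c, w) (0, 0, 0, 0) (0, 0, 0, 0) H (t, x, u, ψ) = _ :=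
    jet₃_of_basic hD h.smooth_H (fun m hm => h.dirDeriv_eU_H hk hm)
      (fun q m hm => h.dirDeriv_ePsi_H hm q) hm c w
  rw [hZ3, hH3] at e
  rw [h.dirDeriv_Z hm 1, h.dirDeriv_Z hm 0 1] at e
  rw [dirDeriv_mk 1 0 _ _ H, dirDeriv_mk 0 1 c w H, dirDeriv_mk 0 1 c w Φ, h.dirDeriv_eU_H hk hm, h.dirDeriv_ePsi_H hm,
    h.dirDeriv_ePsi_H hm, (h.dirDeriv_eU_ΦZ hm).1, h.dirDeriv_ePsi_Φ hm, h.dirDeriv_eX_Φ hk hm,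
    h.Φ_eq hk hm, h.dirDeriv_eT_T hm] at e
  have hre : (conj (dirDeriv (ePsi 1) Φ (t, x, u, ψ) * ψ) * w + conj ψ *
      ((0 : ℝ) • dirDeriv eT Φ (t, x, u, ψ)
        + (1 : ℝ) • (Complex.I / 2 * dirDeriv eT Z (t, x, u, ψ) * ψ) + c • (0 : ℂ)
        + w * dirDeriv (ePsi 1) Φ (t, x, u, ψ) - ((0 * dirDeriv eT Z (t, x, u, ψ) : ℝ) : ℂ) * w)).re
      = 2 * (dirDeriv (ePsi 1) Φ (t, x, u, ψ)).re * (conj ψ * w).re := by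
    generalize dirDeriv (ePsi 1) Φ (t, x, u, ψ) = A
    simp
    ring
  rw [hre] at e
  simp only [smul_eq_mul] at e
  linear_combination e

/-- The coefficient of `ψ_x` in the first equation shows that `φ / ψ` is imaginary. -/
lemma re_A (h : IsSymmetryField p s₁ s₂ k D T Z H Φ) (hk : k ≠ 0) (hs₂ : s₂ ≠ 0) {m : Space}
    (hm : m ∈ D) : (dirDeriv (ePsi 1) Φ m).re = 0 := by
  have hD := h.isOpen
  have key : ∀ {t x u : ℝ} {ψ : ℂ}, (t, x, u, ψ) ∈ D →
      ((dirDeriv (ePsi 1) Φ (t, x, u, ψ)).re : ℂ) * ψ = 0 := by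
    intro t x u ψ hm
    have e1 := h.u_x_condition hk hm 0 ψ rfl
    have e0 := h.u_x_condition hk hm 0 0 rfl
    rcases eq_or_ne ψ 0 with rfl | hψ
    · simp
    have hn : (conj ψ * ψ).re ≠ 0 := by
      rw [mul_comm, Complex.mul_conj]
      simpa using hψ
    have e : 4 * s₂ * (conj ψ * ψ).re * (dirDeriv (ePsi 1) Φ (t, x, u, ψ)).re = 0 := by
      simp only [mul_zero, Complex.zero_re] at e0
      linear_combination e1 - e0
    have := (mul_eq_zero.1 e).resolve_left (by positivity)
    simp [this]
  -- differentiating with respect to `ψ` covers the points with `ψ = 0`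
  obtain ⟨t, x, u, ψ⟩ := m
  have d1 : HasDerivAt (fun y : ℝ => (dirDeriv (ePsi 1) Φ (t, x, u, ψ + y)).re) _ 0 :=
    (Complex.reCLM.hasFDerivAt).comp_hasDerivAt 0 (hasDerivAt_along_psi hD h.smooth_A hm)
  rw [(h.dirDeriv_A hm).1] at d1
  have e := eq_zero_of_hasDerivAt (d1.ofReal_comp.mul (hasDerivAt_ofReal_add ψ))
    ((eventually_along_psi hD hm).mono fun y hy => key hy)
  simpa using e

/-- The coefficient of `u_x` in the first equation. -/
lemma dirDeriv_eT_Z (h : IsSymmetryField p s₁ s₂ k D T Z H Φ) (hk : k ≠ 0) {t x u : ℝ} {ψ : ℂ}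
    (hm : (t, x, u, ψ) ∈ D) :
    dirDeriv eT Z (t, x, u, ψ) = s₁ * (p * u ^ (p - 1) * H (t, x, u, ψ)) := by
  linear_combination h.u_x_condition hk hm 0 0 rfl - h.u_x_condition hk hm 1 0 rfl

lemma kdv_remainder (h : IsSymmetryField p s₁ s₂ k D T Z H Φ) (hk : k ≠ 0) {t x u : ℝ} {ψ : ℂ}
    (hm : (t, x, u, ψ) ∈ D) :
    dirDeriv eT H (t, x, u, ψ) + s₁ * u ^ p * dirDeriv eX H (t, x, u, ψ)
      + dirDeriv eX (dirDeriv eX (dirDeriv eX H)) (t, x, u, ψ) = 0 := by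
  simpa using h.u_x_condition hk hm 0 0 rfl

/-- For `p ≠ 1` the coefficient of `u_x` in the first equation depends on `u` unless `η = 0`. -/
lemma H_eq_zero (h : IsSymmetryField p s₁ s₂ k D T Z H Φ) (hk : k ≠ 0) (hs₁ : s₁ ≠ 0) (hp : p ≠ 0)
    (hp1 : p ≠ 1) (hDp : ∀ m ∈ D, m.2.2.1 ∈ powDomain p) {m : Space} (hm : m ∈ D) : H m = 0 := by
  have hD := h.isOpen
  have key : ∀ {t x u : ℝ} {ψ : ℂ}, (t, x, u, ψ) ∈ D → u * H (t, x, u, ψ) = 0 := by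
    intro t x u ψ hm
    rcases eq_or_ne u 0 with rfl | hu
    · simp
    have d1 := hasDerivAt_along_u hD (smoothOn_dirDeriv hD h.smooth_Z eT) hm
    have d2 := hasDerivAt_along_u hD h.smooth_H hm
    rw [dirDeriv_dirDeriv_eq_zero hD h.smooth_Z (fun m hm => (h.dirDeriv_eU_ΦZ hm).2) eT _ hm] at d1
    rw [h.dirDeriv_eU_H hk hm] at d2
    have d3 := Real.hasDerivAt_rpow_const (x := u) (p := p - 1) (Or.inl hu)
    have e := eq_zero_of_hasDerivAt (d1.sub (((d3.const_mul p).mul d2).const_mul s₁))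
      ((eventually_along_u hD hm).mono fun y hy => sub_eq_zero.2 (h.dirDeriv_eT_Z hk hy))
    have hpow := rpow_sub_ne_zero (hDp _ hm) hu
    have e' : (s₁ * p * (p - 1) * u ^ (p - 1 - 1)) * H (t, x, u, ψ) = 0 := by
      linear_combination -e
    rw [(mul_eq_zero.1 e').resolve_left
      (mul_ne_zero (mul_ne_zero (mul_ne_zero hs₁ hp) (sub_ne_zero.2 hp1)) hpow), mul_zero]
  -- differentiating `u η = 0` with respect to `u` covers the points with `u = 0`
  obtain ⟨t, x, u, ψ⟩ := m
  have d2 := hasDerivAt_along_u hD h.smooth_H hm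
  rw [h.dirDeriv_eU_H hk hm] at d2
  have e := eq_zero_of_hasDerivAt ((hasDerivAt_id u).mul d2)
    ((eventually_along_u hD hm).mono fun y hy => key hy)
  simpa using e

end IsSymmetryField

/-! ### Integration of the determining equations -/

lemma exists_eq_clm_add {F : Type*} [NormedAddCommGroup F] [NormedSpace ℝ F] {D : Set Space}
    {f : Space → F} (hD : IsOpen D) (hc : IsConnected D) (hf : ContDiffOn ℝ ∞ f D)
    (L : Space →L[ℝ] F) (ht : ∀ m ∈ D, dirDeriv eT f m = L eT)
    (hx : ∀ m ∈ D, dirDeriv eX f m = L eX) (hu : ∀ m ∈ D, dirDeriv eU f m = L eU)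
    (hψ : ∀ q, ∀ m ∈ D, dirDeriv (ePsi q) f m = L (ePsi q)) : ∃ c, ∀ m ∈ D, f m = L m + c := by
  have key : ∀ v, ∀ m ∈ D, dirDeriv v (fun m => f m - L m) m = dirDeriv v f m - L v := by
    intro v m hm
    have := ((differentiableAt_of_smoothOn hD hf hm).hasFDerivAt.sub L.hasFDerivAt).fderiv
    change fderiv ℝ (fun m => f m - L m) m v = _
    rw [show (fun m => f m - L m) = f - ⇑L from rfl, this]
    rfl
  obtain ⟨c, h⟩ := exists_eq_const (f := fun m => f m - L m) hD hc.isPreconnected hc.nonempty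
    (hf.sub L.contDiff.contDiffOn)
    (fun m hm => by rw [key _ m hm, ht m hm, sub_self])
    (fun m hm => by rw [key _ m hm, hx m hm, sub_self])
    (fun m hm => by rw [key _ m hm, hu m hm, sub_self])
    (fun q m hm => by rw [key _ m hm, hψ q m hm, sub_self])
  exact ⟨c, fun m hm => by rw [← h m hm]; abel⟩

namespace IsSymmetryField

variable {p s₁ s₂ k : ℝ} {D : Set Space} {T Z H : Space → ℝ} {Φ : Space → ℂ}

/-- `η` is constant, and it vanishes unless `p = 1`. -/
lemma exists_H_eq (h : IsSymmetryField p s₁ s₂ k D T Z H Φ) (hc : IsConnected D) (hk : k ≠ 0)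
    (hs₁ : s₁ ≠ 0) (hp : p ≠ 0) (hs₁p : p = 1 → s₁ = 1) (hDp : ∀ m ∈ D, m.2.2.1 ∈ powDomain p) :
    ∃ c : ℝ, (p ≠ 1 → c = 0) ∧ ∀ m ∈ D, H m = c ∧ dirDeriv eT Z m = c := by
  rcases eq_or_ne p 1 with rfl | hp1
  · have hZ : ∀ m ∈ D, dirDeriv eT Z m = H m := by
      rintro ⟨t, x, u, ψ⟩ hm
      simp [h.dirDeriv_eT_Z hk hm, hs₁p]
    have hx : ∀ m ∈ D, dirDeriv eX H m = 0 := fun m hm => by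
      rw [← dirDeriv_congr h.isOpen hZ hm, h.dirDeriv_eX_eT_Z hm]
    have hxx : ∀ m ∈ D, dirDeriv eX (dirDeriv eX H) m = 0 := fun m hm =>
      dirDeriv_eq_zero h.isOpen hx hm eX
    have ht : ∀ m ∈ D, dirDeriv eT H m = 0 := by
      rintro ⟨t, x, u, ψ⟩ hm
      have := h.kdv_remainder hk hm
      rwa [hx _ hm, dirDeriv_eq_zero h.isOpen hxx hm, mul_zero, add_zero, add_zero] at this
    obtain ⟨c, e⟩ := exists_eq_const h.isOpen hc.isPreconnected hc.nonempty h.smooth_H ht hx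
      (fun m hm => h.dirDeriv_eU_H hk hm) (fun q m hm => h.dirDeriv_ePsi_H hm q)
    exact ⟨c, fun h => absurd rfl h, fun m hm => ⟨e m hm, (hZ m hm).trans (e m hm)⟩⟩
  · refine ⟨0, fun _ => rfl, fun m hm => ?_⟩
    have h0 := h.H_eq_zero hk hs₁ hp hp1 hDp hm
    obtain ⟨t, x, u, ψ⟩ := m
    exact ⟨h0, by rw [h.dirDeriv_eT_Z hk hm, h0]; simp⟩

theorem exists_eq (h : IsSymmetryField p s₁ s₂ k D T Z H Φ) (hc : IsConnected D) (hk : k ≠ 0)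
    (hs₁ : s₁ ≠ 0) (hs₂ : s₂ ≠ 0) (hp : p ≠ 0) (hs₁p : p = 1 → s₁ = 1)
    (hDp : ∀ m ∈ D, m.2.2.1 ∈ powDomain p) :
    ∃ c₁ c₂ c₃ c₄ : ℝ, (p ≠ 1 → c₄ = 0) ∧ ∀ m ∈ D,
      field T Z H Φ m = c₁ • X₁ m + c₂ • X₂ m + c₃ • X₃ m + c₄ • X₄ s₁ k m := by
  obtain ⟨c₄, hc₄, hH⟩ := h.exists_H_eq hc hk hs₁ hp hs₁p hDp
  have hs : c₄ * s₁ = c₄ := by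
    rcases eq_or_ne p 1 with h1 | h1
    · rw [hs₁p h1, mul_one]
    · rw [hc₄ h1, zero_mul]
  obtain ⟨c₁, hT⟩ := exists_eq_const h.isOpen hc.isPreconnected hc.nonempty h.smooth_T
    (fun m hm => h.dirDeriv_eT_T hm) (fun m hm => h.dirDeriv_T_vertical hm 1 0 0)
    (fun m hm => h.dirDeriv_T_vertical hm 0 1 0) (fun q m hm => h.dirDeriv_T_vertical hm 0 0 q)
  obtain ⟨c₂, hZ⟩ := exists_eq_clm_add h.isOpen hc h.smooth_Z
    (c₄ • ContinuousLinearMap.fst ℝ ℝ (ℝ × ℝ × ℂ))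
    (fun m hm => by rw [(hH m hm).2]; simp [eT])
    (fun m hm => by rw [h.dirDeriv_eX_Z hm]; simp [eX])
    (fun m hm => by rw [(h.dirDeriv_eU_ΦZ hm).2]; simp [eU])
    (fun q m hm => by rw [h.dirDeriv_ePsi_Z hm]; simp [ePsi])
  have hA : ∀ v, ∀ m ∈ D, dirDeriv v (fun m => (dirDeriv (ePsi 1) Φ m).im) m
      = (dirDeriv v (dirDeriv (ePsi 1) Φ) m).im := fun v m hm =>
    dirDeriv_clm_comp h.isOpen h.smooth_A hm Complex.imCLM v
  obtain ⟨c₃, hB⟩ := exists_eq_clm_add h.isOpen hc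
    (f := fun m => (dirDeriv (ePsi 1) Φ m).im)
    (Complex.imCLM.contDiff.comp_contDiffOn h.smooth_A)
    (c₄ • (k • ContinuousLinearMap.fst ℝ ℝ (ℝ × ℝ × ℂ)
      + (1 / 2 : ℝ) • (ContinuousLinearMap.fst ℝ ℝ (ℝ × ℂ)).comp
        (ContinuousLinearMap.snd ℝ ℝ (ℝ × ℝ × ℂ))))
    (fun m hm => by
      rw [hA _ m hm, h.dirDeriv_eT_A hk hm, (hH m hm).1]
      simp [eT, mul_comm])
    (fun m hm => by
      rw [hA _ m hm]
      have := congrArg Complex.im (h.dirDeriv_A hm).2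
      rw [(hH m hm).2] at this
      simp only [Complex.mul_im, Complex.re_ofNat, Complex.im_ofNat, zero_mul, add_zero,
        Complex.I_re, Complex.I_im, Complex.ofReal_re, Complex.ofReal_im, one_mul, zero_add] at this
      rw [show (dirDeriv eX (dirDeriv (ePsi 1) Φ) m).im = c₄ / 2 by linarith]
      simp [eX, div_eq_mul_inv])
    (fun m hm => by
      rw [hA _ m hm, h.dirDeriv_eU_A hm]
      simp [eU])
    (fun q m hm => by
      rw [hA _ m hm, (h.dirDeriv_A hm).1]
      simp [ePsi])
  refine ⟨c₁, c₂, c₃, c₄, hc₄, fun m hm => ?_⟩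
  have hΦ : Φ m = ((dirDeriv (ePsi 1) Φ m).im : ℂ) * (Complex.I * m.2.2.2) := by
    have := Complex.re_add_im (dirDeriv (ePsi 1) Φ m)
    rw [h.re_A hk hs₂ hm] at this
    have e : Φ m = dirDeriv (ePsi 1) Φ m * m.2.2.2 := h.Φ_eq hk hm
    rw [e]
    conv_lhs => rw [← this]
    push_cast
    ring
  have hB' : (dirDeriv (ePsi 1) Φ m).im = _ := hB m hm
  rw [hB'] at hΦ
  have hs' : (c₄ : ℂ) * s₁ = c₄ := by exact_mod_cast hs
  refine Prod.ext ?_ (Prod.ext ?_ (Prod.ext ?_ ?_))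
  · simp [field, X₁, X₂, X₃, X₄, hT m hm]
  · simp [field, X₁, X₂, X₃, X₄, hZ m hm]
    ring
  · simp [field, X₁, X₂, X₃, X₄, (hH m hm).1]
  · simp [field, X₁, X₂, X₃, X₄, hΦ]
    linear_combination -k * m.1 * Complex.I * m.2.2.2 * hs'

end IsSymmetryField

/-! ### The four fields generate symmetries -/

section Converse

lemma HasJet.clm_comp {F G : Type*} [NormedAddCommGroup F] [NormedSpace ℝ F]
    [NormedAddCommGroup G] [NormedSpace ℝ G] {f : ℝ → F} {x : ℝ} {a b c d : F}
    (hf : HasJet f x a b c d) (L : F →L[ℝ] G) :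
    HasJet (fun y => L (f y)) x (L a) (L b) (L c) (L d) := by
  obtain ⟨p, q, h1, h2, h3, rfl, rfl, rfl⟩ := hf
  exact ⟨fun y => L (p y), fun y => L (q y),
    h1.mono fun y hy => L.hasFDerivAt.comp_hasDerivAt y hy,
    h2.mono fun y hy => L.hasFDerivAt.comp_hasDerivAt y hy,
    L.hasFDerivAt.comp_hasDerivAt x h3, rfl, rfl, rfl⟩

lemma hasJet_affine (a b x : ℝ) : HasJet (fun y => a + b * y) x (a + b * x) b 0 0 :=
  ⟨fun _ => b, fun _ => 0,
    .of_forall fun y => by simpa using ((hasDerivAt_id y).const_mul b).const_add a,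
    .of_forall fun y => hasDerivAt_const y b, hasDerivAt_const x 0, rfl, rfl, rfl⟩

theorem isPointSymmetry_of_eq {p s₁ s₂ k : ℝ} {D : Set Space} (hD : IsOpen D) {X : Space → Space}
    {c₁ c₂ c₃ c₄ : ℝ} (hs₁p : p = 1 → s₁ = 1) (hc₄ : p ≠ 1 → c₄ = 0)
    (hX : ∀ m ∈ D, X m = c₁ • X₁ m + c₂ • X₂ m + c₃ • X₃ m + c₄ • X₄ s₁ k m) :
    IsPointSymmetry p s₁ s₂ k D X := by
  refine ⟨ContDiffOn.congr (ContDiff.contDiffOn ?_) hX, ?_⟩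
  · have hr : ContDiff ℝ ∞ fun m : Space => s₁ * k * m.1 + m.2.1 / 2 := by fun_prop
    have hre : ContDiff ℝ ∞ fun m : Space => ((s₁ * k * m.1 + m.2.1 / 2 : ℝ) : ℂ) :=
      Complex.ofRealCLM.contDiff.comp hr
    unfold X₁ X₂ X₃ X₄
    fun_prop
  intro u ψ hu hψ t x hm hs
  have hu : SmoothOn Set.univ u := contDiffOn_univ.2 hu
  have hψ : SmoothOn Set.univ ψ := contDiffOn_univ.2 hψ
  have ho : IsOpen (Set.univ : Set (ℝ × ℝ)) := isOpen_univ
  have hx : ∀ᶠ y in 𝓝 x, X (t, y, u t y, ψ t y) = (c₁, c₂ + c₄ * t, c₄,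
      ((c₃ + c₄ * s₁ * k * t) + c₄ / 2 * y) • (Complex.I * ψ t y)) := by
    have hcont : ContinuousAt (fun y => ((t, y, u t y, ψ t y) : Space)) x :=
      continuousAt_const.prodMk (continuousAt_id.prodMk
        ((hu.hasDerivAt_right ho trivial).continuousAt.prodMk
          (hψ.hasDerivAt_right ho trivial).continuousAt))
    filter_upwards [hcont.eventually_mem (hD.mem_nhds hm)] with y hy
    rw [hX _ hy]
    refine Prod.ext ?_ (Prod.ext ?_ (Prod.ext ?_ ?_)) <;> simp [X₁, X₂, X₃, X₄]
    ring
  have ht : ∀ᶠ y in 𝓝 t, X (y, x, u y x, ψ y x) = (c₁, c₂ + c₄ * y, c₄,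
      ((c₃ + c₄ / 2 * x) + c₄ * s₁ * k * y) • (Complex.I * ψ y x)) := by
    have hcont : ContinuousAt (fun y => ((y, x, u y x, ψ y x) : Space)) t :=
      continuousAt_id.prodMk (continuousAt_const.prodMk
        ((hu.hasDerivAt_left ho trivial).continuousAt.prodMk
          (hψ.hasDerivAt_left ho trivial).continuousAt))
    filter_upwards [hcont.eventually_mem (hD.mem_nhds hm)] with y hy
    rw [hX _ hy]
    refine Prod.ext ?_ (Prod.ext ?_ (Prod.ext ?_ ?_)) <;> simp [X₁, X₂, X₃, X₄]
    ring
  have jT : HasJet (fun y => (X (t, y, u t y, ψ t y)).1) x c₁ 0 0 0 :=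
    (hasJet_const c₁ x).congr (hx.mono fun y hy => congrArg (fun v => v.1) hy)
  have jZ : HasJet (fun y => (X (t, y, u t y, ψ t y)).2.1) x (c₂ + c₄ * t) 0 0 0 :=
    (hasJet_const (c₂ + c₄ * t) x).congr (hx.mono fun y hy => congrArg (fun v => v.2.1) hy)
  have jH : HasJet (fun y => (X (t, y, u t y, ψ t y)).2.2.1) x c₄ 0 0 0 :=
    (hasJet_const c₄ x).congr (hx.mono fun y hy => congrArg (fun v => v.2.2.1) hy)
  have jΦ : HasJet (fun y => (X (t, y, u t y, ψ t y)).2.2.2) x _ _ _ _ :=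
    ((hasJet_affine (c₃ + c₄ * s₁ * k * t) (c₄ / 2) x).smul ((hψ.hasJet ho trivial).clm_comp
      (ContinuousLinearMap.mul ℝ ℂ Complex.I))).congr
      (hx.mono fun y hy => congrArg (fun v => v.2.2.2) hy)
  have dT : HasDerivAt (fun y => (X (y, x, u y x, ψ y x)).1) 0 t :=
    (hasDerivAt_const t c₁).congr_of_eventuallyEq (ht.mono fun y hy => congrArg (fun v => v.1) hy)
  have dZ : HasDerivAt (fun y => (X (y, x, u y x, ψ y x)).2.1) _ t :=
    (((hasDerivAt_id t).const_mul c₄).const_add c₂).congr_of_eventuallyEq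
      (ht.mono fun y hy => congrArg (fun v => v.2.1) hy)
  have dH : HasDerivAt (fun y => (X (y, x, u y x, ψ y x)).2.2.1) 0 t :=
    (hasDerivAt_const t c₄).congr_of_eventuallyEq
      (ht.mono fun y hy => congrArg (fun v => v.2.2.1) hy)
  have dΦ : HasDerivAt (fun y => (X (y, x, u y x, ψ y x)).2.2.2) _ t :=
    ((((hasDerivAt_id t).const_mul (c₄ * s₁ * k)).const_add (c₃ + c₄ / 2 * x)).smul
      ((hψ.hasDerivAt_left ho trivial).const_mul Complex.I)).congr_of_eventuallyEq
      (ht.mono fun y hy => congrArg (fun v => v.2.2.2) hy)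
  have hc : s₁ * (p * u t x ^ (p - 1) * c₄) = c₄ := by
    rcases eq_or_ne p 1 with rfl | h1
    · simp [hs₁p]
    · simp [hc₄ h1]
  have hs' : (c₄ : ℂ) * s₁ = c₄ := by
    rcases eq_or_ne p 1 with h1 | h1
    · simp [hs₁p h1]
    · simp [hc₄ h1]
  have hls := hs.2.1
  unfold ls at hls
  unfold prKdv prLs
  rw [prU_one_zero hu dT dZ dH, prU_zero_zero, prU_zero_one hu jT jZ jH,
    prU_zero_three hu jT jZ jH, prPsi_zero_zero, prPsi_zero_one hψ jT jZ jΦ,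
    prPsi_one_zero hψ dT dZ dΦ, prPsi_zero_two hψ jT jZ jΦ, hx.self_of_nhds]
  constructor
  · generalize c₃ + c₄ * s₁ * k * t + c₄ / 2 * x = α
    generalize c₄ / 2 = β
    simp
    linear_combination Dx u t x * hc
  · simp
    linear_combination Complex.I * (c₃ + c₄ * s₁ * k * t + c₄ / 2 * x) * hls
      - k * ψ t x * hs' + c₄ * s₁ * k * ψ t x * Complex.I_mul_I

end Converse

/-! ### Linear independence and commutators -/

lemma linearIndependent_fields {D : Set Space} (hD : IsOpen D) (hne : D.Nonempty) (s₁ k : ℝ) :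
    LinearIndependent ℝ ![D.domRestrict X₁, D.domRestrict X₂, D.domRestrict X₃,
      D.domRestrict (X₄ s₁ k)] := by
  rw [Fintype.linearIndependent_iff]
  intro g hg
  have hval : ∀ m ∈ D, g 0 • X₁ m + g 1 • X₂ m + g 2 • X₃ m + g 3 • X₄ s₁ k m = 0 := by
    intro m hm
    have := congrFun hg ⟨m, hm⟩
    simpa [Fin.sum_univ_four, Set.domRestrict] using this
  -- a point of `D` with `ψ ≠ 0`, where `X₃` does not vanish
  obtain ⟨m, hm, hψ⟩ : ∃ m ∈ D, m.2.2.2 ≠ 0 := by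
    obtain ⟨⟨t, x, u, ψ⟩, hm⟩ := hne
    rcases eq_or_ne ψ 0 with rfl | hψ
    · have hev : ∀ᶠ y : ℝ in 𝓝[≠] 0, (t, x, u, (0 : ℂ) + y) ∈ D ∧ y ≠ 0 :=
        ((eventually_along_psi hD hm).filter_mono nhdsWithin_le_nhds).and self_mem_nhdsWithin
      obtain ⟨y, hy, hy0⟩ := hev.exists
      exact ⟨_, hy, by simpa using hy0⟩
    · exact ⟨_, hm, hψ⟩
  have e := hval m hm
  have e0 : g 0 = 0 := by simpa [X₁, X₂, X₃, X₄] using congrArg (fun v : Space => v.1) e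
  have e3 : g 3 = 0 := by simpa [X₁, X₂, X₃, X₄] using congrArg (fun v : Space => v.2.2.1) e
  have e1 : g 1 = 0 := by simpa [X₁, X₂, X₃, X₄, e3] using congrArg (fun v : Space => v.2.1) e
  have e2 : g 2 = 0 := by
    simpa [X₁, X₂, X₃, X₄, e3, hψ] using congrArg (fun v : Space => v.2.2.2) e
  intro i
  fin_cases i <;> assumption

lemma fderiv_X₃ (m v : Space) : fderiv ℝ X₃ m v = (0, 0, 0, Complex.I * v.2.2.2) := by
  have hd : DifferentiableAt ℝ X₃ m := by unfold X₃; fun_prop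
  rw [← hd.lineDeriv_eq_fderiv]
  refine HasDerivAt.deriv ((hasDerivAt_const _ _).prodMk ((hasDerivAt_const _ _).prodMk
    ((hasDerivAt_const _ _).prodMk (HasDerivAt.const_mul Complex.I ?_))))
  simpa using ((hasDerivAt_id (0 : ℝ)).smul_const v.2.2.2).const_add m.2.2.2

lemma fderiv_X₄ (s₁ k : ℝ) (m v : Space) : fderiv ℝ (X₄ s₁ k) m v =
    (0, v.1, 0, ((s₁ * k * v.1 + v.2.1 / 2 : ℝ) : ℂ) * (Complex.I * m.2.2.2)
      + ((s₁ * k * m.1 + m.2.1 / 2 : ℝ) : ℂ) * (Complex.I * v.2.2.2)) := by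
  have hr : DifferentiableAt ℝ (fun m : Space => s₁ * k * m.1 + m.2.1 / 2) m := by fun_prop
  have hre : DifferentiableAt ℝ (fun m : Space => ((s₁ * k * m.1 + m.2.1 / 2 : ℝ) : ℂ)) m :=
    Complex.ofRealCLM.differentiableAt.comp m hr
  have hd : DifferentiableAt ℝ (X₄ s₁ k) m := by unfold X₄; fun_prop
  have h1 : HasDerivAt (fun y : ℝ => (m + y • v).1) v.1 0 := by
    simpa using ((hasDerivAt_id (0 : ℝ)).smul_const v.1).const_add m.1
  have h2 : HasDerivAt (fun y : ℝ => (m + y • v).2.1) v.2.1 0 := by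
    simpa using ((hasDerivAt_id (0 : ℝ)).smul_const v.2.1).const_add m.2.1
  have h4 : HasDerivAt (fun y : ℝ => (m + y • v).2.2.2) v.2.2.2 0 := by
    simpa using ((hasDerivAt_id (0 : ℝ)).smul_const v.2.2.2).const_add m.2.2.2
  rw [← hd.lineDeriv_eq_fderiv]
  refine HasDerivAt.deriv ((hasDerivAt_const _ _).prodMk (h1.prodMk
    ((hasDerivAt_const _ _).prodMk ((((h1.const_mul (s₁ * k)).add
      (h2.div_const 2)).ofReal_comp.mul (h4.const_mul Complex.I)).congr_deriv ?_))))
  simp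

lemma fderiv_X₁ (m : Space) : fderiv ℝ X₁ m = 0 := by
  unfold X₁
  simp

lemma fderiv_X₂ (m : Space) : fderiv ℝ X₂ m = 0 := by
  unfold X₂
  simp

theorem lieBracket_fields (s₁ k : ℝ) :
    VectorField.lieBracket ℝ X₁ X₂ = 0 ∧ VectorField.lieBracket ℝ X₁ X₃ = 0 ∧
      VectorField.lieBracket ℝ X₂ X₃ = 0 ∧
      VectorField.lieBracket ℝ X₁ (X₄ s₁ k) = X₂ + (s₁ * k) • X₃ ∧
      VectorField.lieBracket ℝ X₂ (X₄ s₁ k) = (1 / 2 : ℝ) • X₃ ∧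
      VectorField.lieBracket ℝ X₃ (X₄ s₁ k) = 0 := by
  refine ⟨?_, ?_, ?_, ?_, ?_, ?_⟩ <;> ext1 m <;>
    simp only [VectorField.lieBracket_eq, fderiv_X₁, fderiv_X₂, fderiv_X₃, fderiv_X₄]
  · simp
  · simp [X₁]
  · simp [X₂]
  · simp [X₁, X₂, X₃]
  · simp [X₂, X₃]
  · simp [X₃, X₄]
    ring

/-! ### One-parameter groups -/

lemma isFlowOf_timeShift : IsFlowOf X₁ timeShift := by
  refine ⟨fun m => by simp [timeShift], fun a b m => ?_, fun ε m => ?_⟩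
  · simp only [timeShift, Prod.mk.injEq, and_true]
    ring
  · exact ((hasDerivAt_id ε).const_add m.1).prodMk (hasDerivAt_const _ _)

lemma isFlowOf_spaceShift : IsFlowOf X₂ spaceShift := by
  refine ⟨fun m => by simp [spaceShift], fun a b m => ?_, fun ε m => ?_⟩
  · simp only [spaceShift, Prod.mk.injEq, and_true, true_and]
    ring
  · exact (hasDerivAt_const _ _).prodMk (((hasDerivAt_id ε).const_add m.2.1).prodMk
      (hasDerivAt_const _ _))

lemma isFlowOf_phaseRotation : IsFlowOf X₃ phaseRotation := by
  refine ⟨fun m => by simp [phaseRotation], fun a b m => ?_, fun ε m => ?_⟩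
  · simp only [phaseRotation, Prod.mk.injEq, true_and]
    rw [← mul_assoc, ← Complex.exp_add]
    push_cast
    ring_nf
  · have h : HasDerivAt (fun e : ℝ => Complex.I * (e : ℂ)) (Complex.I * 1) ε :=
      ((hasDerivAt_id ε).ofReal_comp).const_mul Complex.I
    refine (hasDerivAt_const _ _).prodMk ((hasDerivAt_const _ _).prodMk
      ((hasDerivAt_const _ _).prodMk ((h.cexp.mul_const m.2.2.2).congr_deriv ?_)))
    simp only [phaseRotation]
    ring

lemma isFlowOf_galileanBoost (k : ℝ) : IsFlowOf (X₄ 1 k) (galileanBoost k) := by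
  refine ⟨fun m => by simp [galileanBoost], fun a b m => ?_, fun ε m => ?_⟩
  · simp only [galileanBoost, Prod.mk.injEq, true_and]
    refine ⟨by ring, by ring, ?_⟩
    rw [← mul_assoc, ← Complex.exp_add]
    push_cast
    ring_nf
  · have h : HasDerivAt (fun e : ℝ => e * (k * m.1 + m.2.1 / 2) + e ^ 2 * m.1 / 4)
        (k * m.1 + (m.2.1 + ε * m.1) / 2) ε := by
      refine (((hasDerivAt_id ε).mul_const (k * m.1 + m.2.1 / 2)).add
        ((((hasDerivAt_id ε).pow 2).mul_const m.1).div_const 4)).congr_deriv ?_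
      simp
      ring
    refine (hasDerivAt_const _ _).prodMk
      ((((hasDerivAt_id ε).mul_const m.1).const_add m.2.1 |>.congr_deriv (one_mul _)).prodMk
      (((hasDerivAt_id ε).const_add m.2.2.1).prodMk
        (((h.ofReal_comp.const_mul Complex.I).cexp.mul_const m.2.2.2).congr_deriv ?_)))
    simp only [galileanBoost]
    push_cast
    ring

/-! ### Action on solutions -/

lemma graphOver_eq_image {g : Space → Space} {Ω Ω' : Set (ℝ × ℝ)} {u u' : ℝ → ℝ → ℝ}
    {ψ ψ' : ℝ → ℝ → ℂ} (σ τ : ℝ × ℝ → ℝ × ℝ) (hσ : ∀ q ∈ Ω', σ q ∈ Ω) (hτ : ∀ q ∈ Ω, τ q ∈ Ω')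
    (hτσ : ∀ q, τ (σ q) = q)
    (h : ∀ q, ((τ q).1, (τ q).2, u' (τ q).1 (τ q).2, ψ' (τ q).1 (τ q).2)
      = g (q.1, q.2, u q.1 q.2, ψ q.1 q.2)) :
    graphOver Ω' u' ψ' = g '' graphOver Ω u ψ := by
  ext m
  constructor
  · rintro ⟨q, hq, rfl⟩
    refine ⟨_, ⟨σ q, hσ q hq, rfl⟩, ?_⟩
    simp only [← h, hτσ]
  · rintro ⟨_, ⟨q, hq, rfl⟩, rfl⟩
    exact ⟨τ q, hτ q hq, h q⟩

lemma mapsSolutions_timeShift (p s₁ s₂ k ε : ℝ) : MapsSolutions p s₁ s₂ k (timeShift ε) := by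
  intro Ω u ψ h
  have hc : ContDiff ℝ ∞ fun q : ℝ × ℝ => (q.1 - ε, q.2) := by fun_prop
  have hDt : ∀ {F : Type} [NormedAddCommGroup F] [NormedSpace ℝ F] (f : ℝ → ℝ → F),
      Dt (fun t x => f (t - ε) x) = fun t x => Dt f (t - ε) x := fun f =>
    funext₂ fun t x => deriv_comp_sub_const (fun s => f s x) ε t
  refine ⟨(fun q : ℝ × ℝ => (q.1 - ε, q.2)) ⁻¹' Ω, fun t x => u (t - ε) x,
    fun t x => ψ (t - ε) x, ⟨h.isOpen.preimage hc.continuous,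
      h.smooth_u.comp hc.contDiffOn fun _ hq => hq, h.smooth_psi.comp hc.contDiffOn fun _ hq => hq,
      fun q hq => h.mem_powDomain _ hq, fun q hq => ?_, fun q hq => ?_⟩,
    graphOver_eq_image (fun q => (q.1 - ε, q.2)) (fun q => (q.1 + ε, q.2)) (fun _ hq => hq)
      (fun q hq => by simpa using hq) (fun q => by simp) (fun q => by simp [timeShift])⟩
  · rw [← h.kdv_eq _ hq]
    simp only [kdv, hDt]
    rfl
  · rw [← h.ls_eq _ hq]
    simp only [ls, hDt]
    rfl

lemma Dx_comp_sub {F : Type*} [NormedAddCommGroup F] [NormedSpace ℝ F] (f : ℝ → ℝ → F)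
    (a : ℝ → ℝ) : Dx (fun t x => f t (x - a t)) = fun t x => Dx f t (x - a t) :=
  funext₂ fun t x => deriv_comp_sub_const (f t) (a t) x

lemma mapsSolutions_spaceShift (p s₁ s₂ k ε : ℝ) : MapsSolutions p s₁ s₂ k (spaceShift ε) := by
  intro Ω u ψ h
  have hc : ContDiff ℝ ∞ fun q : ℝ × ℝ => (q.1, q.2 - ε) := by fun_prop
  have hDx : ∀ {F : Type} [NormedAddCommGroup F] [NormedSpace ℝ F] (f : ℝ → ℝ → F),
      Dx (fun t x => f t (x - ε)) = fun t x => Dx f t (x - ε) := fun f => Dx_comp_sub f fun _ => ε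
  refine ⟨(fun q : ℝ × ℝ => (q.1, q.2 - ε)) ⁻¹' Ω, fun t x => u t (x - ε),
    fun t x => ψ t (x - ε), ⟨h.isOpen.preimage hc.continuous,
      h.smooth_u.comp hc.contDiffOn fun _ hq => hq, h.smooth_psi.comp hc.contDiffOn fun _ hq => hq,
      fun q hq => h.mem_powDomain _ hq, fun q hq => ?_, fun q hq => ?_⟩,
    graphOver_eq_image (fun q => (q.1, q.2 - ε)) (fun q => (q.1, q.2 + ε)) (fun _ hq => hq)
      (fun q hq => by simpa using hq) (fun q => by simp) (fun q => by simp [spaceShift])⟩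
  · rw [← h.kdv_eq _ hq]
    simp only [kdv, hDx, hDx fun t x => ‖ψ t x‖ ^ 2]
    rfl
  · rw [← h.ls_eq _ hq]
    simp only [ls, hDx]
    rfl

lemma mapsSolutions_phaseRotation (p s₁ s₂ k ε : ℝ) :
    MapsSolutions p s₁ s₂ k (phaseRotation ε) := by
  intro Ω u ψ h
  set c := Complex.exp (Complex.I * (ε : ℂ)) with hc
  have hn : ‖c‖ = 1 := by rw [hc, mul_comm, Complex.norm_exp_ofReal_mul_I]
  have hDt : ∀ f : ℝ → ℝ → ℂ, Dt (fun t x => c * f t x) = fun t x => c * Dt f t x := fun f =>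
    funext₂ fun t x => deriv_const_mul_field c
  have hDx : ∀ f : ℝ → ℝ → ℂ, Dx (fun t x => c * f t x) = fun t x => c * Dx f t x := fun f =>
    funext₂ fun t x => deriv_const_mul_field c
  refine ⟨Ω, u, fun t x => c * ψ t x, ⟨h.isOpen, h.smooth_u, contDiffOn_const.mul h.smooth_psi,
      h.mem_powDomain, fun q hq => ?_, fun q hq => ?_⟩,
    graphOver_eq_image id id (fun _ hq => hq) (fun _ hq => hq) (fun _ => rfl) (fun _ => rfl)⟩
  · rw [← h.kdv_eq _ hq]
    simp only [kdv, norm_mul, hn, one_mul]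
  · have e := h.ls_eq _ hq
    simp only [ls, hDt, hDx] at e ⊢
    linear_combination c * e

/-- With `p = 1` and `s₁ = 1`, the first equation for the boosted pair has the extra terms
`-ε u_x` from `u_t` and `ε u_x` from `u u_x`, which cancel; in the second one the phase cancels
`ε k ψ` and `-i ε ψ_x`. -/
lemma mapsSolutions_galileanBoost (s₂ k ε : ℝ) : MapsSolutions 1 1 s₂ k (galileanBoost k ε) := by
  intro Ω u ψ h
  have hc : ContDiff ℝ ∞ fun q : ℝ × ℝ => (q.1, q.2 - ε * q.1) := by fun_prop
  have hΩ := h.isOpen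
  have hu : SmoothOn Ω u := h.smooth_u
  have hψ : SmoothOn Ω ψ := h.smooth_psi
  let θ : ℝ → ℝ → ℝ := fun t x => ε * (k * t + (x - ε * t) / 2) + ε ^ 2 * t / 4
  let E : ℝ → ℝ → ℂ := fun t x => Complex.exp (Complex.I * (θ t x : ℂ))
  have hn : ∀ t x, ‖E t x‖ = 1 := fun t x => by
    simp only [E]
    rw [mul_comm, Complex.norm_exp_ofReal_mul_I]
  have hEs : ContDiff ℝ ∞ fun q : ℝ × ℝ => E q.1 q.2 := by
    have hθ : ContDiff ℝ ∞ fun q : ℝ × ℝ => θ q.1 q.2 := by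
      simp only [θ]
      fun_prop
    exact (contDiff_const.mul (Complex.ofRealCLM.contDiff.comp hθ)).cexp
  have hEx : ∀ t x, HasDerivAt (E t) (E t x * (Complex.I * (ε / 2 : ℝ))) x := by
    intro t x
    have hθ : HasDerivAt (θ t) (ε / 2) x := by
      refine ((((((hasDerivAt_id x).sub_const (ε * t)).div_const 2).const_add (k * t)).const_mul
        ε).add_const (ε ^ 2 * t / 4)).congr_deriv ?_
      ring
    exact (hθ.ofReal_comp.const_mul Complex.I).cexp
  have hEt : ∀ t x, HasDerivAt (fun s => E s x)
      (E t x * (Complex.I * (ε * k - ε ^ 2 / 4 : ℝ))) t := by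
    intro t x
    have hθ : HasDerivAt (fun s => θ s x) (ε * k - ε ^ 2 / 4) t := by
      have hid := hasDerivAt_id t
      refine (((((hid.const_mul k).add (((hid.const_mul ε).const_sub x).div_const 2)).const_mul
        ε)).add ((hid.const_mul (ε ^ 2)).div_const 4)).congr_deriv ?_
      ring
    exact (hθ.ofReal_comp.const_mul Complex.I).cexp
  -- derivatives of functions composed with the boost
  have hx : ∀ {f : ℝ → ℝ → ℂ} {t x : ℝ}, SmoothOn Ω f → (t, x - ε * t) ∈ Ω →
      HasDerivAt (fun y => f t (y - ε * t)) (Dx f t (x - ε * t)) x := by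
    intro f t x hf hm
    simpa using hf.hasDerivAt_comp hΩ (hasDerivAt_const x t)
      ((hasDerivAt_id x).sub_const (ε * t)) hm
  have ht : ∀ {F : Type} [NormedAddCommGroup F] [NormedSpace ℝ F] {f : ℝ → ℝ → F} {t x : ℝ},
      SmoothOn Ω f → (t, x - ε * t) ∈ Ω → HasDerivAt (fun s => f s (x - ε * s))
        (Dt f t (x - ε * t) + (-ε) • Dx f t (x - ε * t)) t := by
    intro F _ _ f t x hf hm
    simpa using hf.hasDerivAt_comp hΩ (hasDerivAt_id t)
      (((hasDerivAt_id t).const_mul ε).const_sub x) hm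
  have hΩ' : IsOpen ((fun q : ℝ × ℝ => (q.1, q.2 - ε * q.1)) ⁻¹' Ω) := hΩ.preimage hc.continuous
  refine ⟨(fun q : ℝ × ℝ => (q.1, q.2 - ε * q.1)) ⁻¹' Ω, fun t x => u t (x - ε * t) + ε,
    fun t x => E t x * ψ t (x - ε * t), ⟨hΩ',
      (h.smooth_u.comp hc.contDiffOn fun _ hq => hq).add contDiffOn_const,
      hEs.contDiffOn.mul (h.smooth_psi.comp hc.contDiffOn fun _ hq => hq),
      fun q hq => Or.inl ⟨1, by simp⟩, fun q hq => ?_, fun q hq => ?_⟩,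
    graphOver_eq_image (fun q => (q.1, q.2 - ε * q.1)) (fun q => (q.1, q.2 + ε * q.1))
      (fun _ hq => hq) (fun q hq => by simpa using hq) (fun q => by simp)
      (fun q => by simp [galileanBoost, E, θ])⟩
  · obtain ⟨t, x⟩ := q
    have e := h.kdv_eq _ hq
    have eDx : Dx (fun t x => u t (x - ε * t) + ε) = fun t x => Dx u t (x - ε * t) := by
      funext t x
      refine (deriv_add_const ε).trans ?_
      exact congrFun₂ (Dx_comp_sub u fun t => ε * t) t x
    have eDt : Dt (fun t x => u t (x - ε * t) + ε) t x
        = Dt u t (x - ε * t) + (-ε) • Dx u t (x - ε * t) := ((ht hu hq).add_const ε).deriv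
    simp only [kdv, norm_mul, hn, one_mul, eDt, eDx, Real.rpow_one, smul_eq_mul,
      Dx_comp_sub (Dx u) fun t => ε * t, Dx_comp_sub (Dx (Dx u)) fun t => ε * t,
      Dx_comp_sub (fun t x => ‖ψ t x‖ ^ 2) fun t => ε * t] at e ⊢
    linear_combination e
  · obtain ⟨t, x⟩ := q
    have e := h.ls_eq _ hq
    have eDt : Dt (fun t x => E t x * ψ t (x - ε * t)) t x = _ :=
      ((hEt t x).mul (ht hψ hq)).deriv
    have eDx : ∀ q : ℝ × ℝ, q ∈ (fun q : ℝ × ℝ => (q.1, q.2 - ε * q.1)) ⁻¹' Ω →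
        Dx (fun t x => E t x * ψ t (x - ε * t)) q.1 q.2 = _ :=
      fun q hq => ((hEx q.1 q.2).mul (hx hψ hq)).deriv
    have eDxx : Dx (Dx (fun t x => E t x * ψ t (x - ε * t))) t x = _ :=
      (Dx_congr (g := fun t x => E t x * (Complex.I * (ε / 2 : ℝ)) * ψ t (x - ε * t)
        + E t x * Dx ψ t (x - ε * t)) hΩ' eDx hq).trans
      ((((hEx t x).mul_const (Complex.I * (ε / 2 : ℝ))).mul (hx hψ hq)).add
        ((hEx t x).mul (hx (hψ.Dx hΩ) hq))).deriv
    simp only [ls, eDt, eDxx, Complex.real_smul] at e ⊢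
    push_cast
    linear_combination E t x * e
      + E t x * ψ t (x - ε * t) * (ε * k) * Complex.I_mul_I

end

end GKdVLS

theorem proposition2 (p s₁ s₂ k : ℝ) (hp : p ≠ 0) (hk : k ≠ 0)
    (hs₁ : s₁ = 1 ∨ s₁ = -1) (hs₂ : s₂ = 1 ∨ s₂ = -1) (hs₁p : p = 1 → s₁ = 1) :
    -- classification of the generators on an arbitrary domain `D` of `(t, x, u, ψ)`-space
    (∀ D : Set GKdVLS.Space, IsOpen D → IsConnected D → (∀ m ∈ D, m.2.2.1 ∈ GKdVLS.powDomain p) →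
      -- the four fields are linearly independent on `D`
      LinearIndependent ℝ ![D.domRestrict GKdVLS.X₁, D.domRestrict GKdVLS.X₂, D.domRestrict GKdVLS.X₃,
        D.domRestrict (GKdVLS.X₄ s₁ k)] ∧
      (p ≠ 1 → ∀ X : GKdVLS.Space → GKdVLS.Space,
        GKdVLS.IsPointSymmetry p s₁ s₂ k D X ↔
          ∃ c₁ c₂ c₃ : ℝ, ∀ m ∈ D,
            X m = c₁ • GKdVLS.X₁ m + c₂ • GKdVLS.X₂ m + c₃ • GKdVLS.X₃ m) ∧
      (p = 1 → ∀ X : GKdVLS.Space → GKdVLS.Space,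
        GKdVLS.IsPointSymmetry p s₁ s₂ k D X ↔
          ∃ c₁ c₂ c₃ c₄ : ℝ, ∀ m ∈ D,
            X m = c₁ • GKdVLS.X₁ m + c₂ • GKdVLS.X₂ m + c₃ • GKdVLS.X₃ m
              + c₄ • GKdVLS.X₄ s₁ k m)) ∧
    -- the transformation groups of the first three generators
    (GKdVLS.IsFlowOf GKdVLS.X₁ GKdVLS.timeShift ∧
      GKdVLS.IsFlowOf GKdVLS.X₂ GKdVLS.spaceShift ∧
      GKdVLS.IsFlowOf GKdVLS.X₃ GKdVLS.phaseRotation ∧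
      ∀ ε : ℝ, GKdVLS.MapsSolutions p s₁ s₂ k (GKdVLS.timeShift ε) ∧
        GKdVLS.MapsSolutions p s₁ s₂ k (GKdVLS.spaceShift ε) ∧
        GKdVLS.MapsSolutions p s₁ s₂ k (GKdVLS.phaseRotation ε)) ∧
    -- the Galilean group
    (p = 1 → GKdVLS.IsFlowOf (GKdVLS.X₄ s₁ k) (GKdVLS.galileanBoost k) ∧
      ∀ ε : ℝ, GKdVLS.MapsSolutions p s₁ s₂ k (GKdVLS.galileanBoost k ε)) ∧
    -- the commutators
    (VectorField.lieBracket ℝ GKdVLS.X₁ GKdVLS.X₂ = 0 ∧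
      VectorField.lieBracket ℝ GKdVLS.X₁ GKdVLS.X₃ = 0 ∧
      VectorField.lieBracket ℝ GKdVLS.X₂ GKdVLS.X₃ = 0 ∧
      VectorField.lieBracket ℝ GKdVLS.X₁ (GKdVLS.X₄ s₁ k) = GKdVLS.X₂ + (s₁ * k) • GKdVLS.X₃ ∧
      VectorField.lieBracket ℝ GKdVLS.X₂ (GKdVLS.X₄ s₁ k) = (1 / 2 : ℝ) • GKdVLS.X₃ ∧
      VectorField.lieBracket ℝ GKdVLS.X₃ (GKdVLS.X₄ s₁ k) = 0) := by
  have hs₁0 : s₁ ≠ 0 := by rcases hs₁ with rfl | rfl <;> norm_num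
  have hs₂0 : s₂ ≠ 0 := by rcases hs₂ with rfl | rfl <;> norm_num
  refine ⟨fun D hD hc hDp => ?_, ⟨GKdVLS.isFlowOf_timeShift, GKdVLS.isFlowOf_spaceShift,
    GKdVLS.isFlowOf_phaseRotation, fun ε => ⟨GKdVLS.mapsSolutions_timeShift p s₁ s₂ k ε,
      GKdVLS.mapsSolutions_spaceShift p s₁ s₂ k ε,
      GKdVLS.mapsSolutions_phaseRotation p s₁ s₂ k ε⟩⟩, ?_, GKdVLS.lieBracket_fields s₁ k⟩
  · have key : ∀ X, GKdVLS.IsPointSymmetry p s₁ s₂ k D X → ∃ c₁ c₂ c₃ c₄ : ℝ, (p ≠ 1 → c₄ = 0) ∧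
        ∀ m ∈ D, X m = c₁ • GKdVLS.X₁ m + c₂ • GKdVLS.X₂ m + c₃ • GKdVLS.X₃ m
          + c₄ • GKdVLS.X₄ s₁ k m := by
      intro X hX
      have h : GKdVLS.IsSymmetryField p s₁ s₂ k D (fun m => (X m).1) (fun m => (X m).2.1)
          (fun m => (X m).2.2.1) (fun m => (X m).2.2.2) :=
        ⟨hD, hX.1.fst, hX.1.snd.fst, hX.1.snd.snd.fst, hX.1.snd.snd.snd, hX⟩
      exact h.exists_eq hc hk hs₁0 hs₂0 hp hs₁p hDp
    refine ⟨GKdVLS.linearIndependent_fields hD hc.nonempty s₁ k, fun hp1 X => ⟨fun hX => ?_, ?_⟩,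
      fun hp1 X => ⟨fun hX => ?_, ?_⟩⟩
    · obtain ⟨c₁, c₂, c₃, c₄, hc₄, h⟩ := key X hX
      exact ⟨c₁, c₂, c₃, fun m hm => by rw [h m hm, hc₄ hp1, zero_smul, add_zero]⟩
    · rintro ⟨c₁, c₂, c₃, h⟩
      exact GKdVLS.isPointSymmetry_of_eq hD (c₁ := c₁) (c₂ := c₂) (c₃ := c₃)
        (c₄ := 0) hs₁p (fun _ => rfl)
        fun m hm => by rw [h m hm, zero_smul, add_zero]
    · obtain ⟨c₁, c₂, c₃, c₄, -, h⟩ := key X hX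
      exact ⟨c₁, c₂, c₃, c₄, h⟩
    · rintro ⟨c₁, c₂, c₃, c₄, h⟩
      exact GKdVLS.isPointSymmetry_of_eq hD hs₁p (fun h1 => absurd hp1 h1) h
  · rintro rfl
    obtain rfl := hs₁p rfl
    exact ⟨GKdVLS.isFlowOf_galileanBoost k, fun ε => GKdVLS.mapsSolutions_galileanBoost s₂ k ε⟩
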